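/- **Setting.** Let $V$ be a finite set of $K\ge 2$ vertices. Let $\rho$ be a measure on $\mathbb R$, let $\Theta$ be the interior of $\{\theta:\int e^{\theta x}d\rho(x)<\infty\}$, $b(\theta)=\ln\int e^{\theta x}d\rho(x)$, and for $\theta\in\Theta$ let $\nu_\theta$ be the law with $d\nu_\theta/d\rho(x)=e^{\theta x-b(\theta)}$ (mean $\dot b(\theta)$). A model $\nu=(G,(\nu_u)_{u\in V})$ consists of edge probabilities $G\in[0,1]^{V\times V}$ and reward laws $\nu_u=\nu_{\theta_u}$, $\theta_u\in\Theta$, with means $\mu_u$. It is assumed that for every $u$ there is $v$ with $G_{v,u}>0$ (observability), and that $a^\star=\arg\max_u\mu_u$ is unique. In round $t=1,2,\dots$ the learner chooses $V_t\in V$ and observes $Z_{t,u}=Y_{t,(V_t,u)}R_{t,u}$, $u\in V$, where all $Y_{t,(v,u)}\sim{\rm Ber}(G_{v,u})$ and $R_{t,u}\sim\nu_u$ are independent. Consider either the uninformed case (neither the graph nor the activated edges are known), where $\rho$ is assumed to have no atoms (continuous rewards), or the informed case, where the set $E_t=\{u:Y_{t,(V_t,u)}=1\}$ is also revealed and $G$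 is either unknown or known. **Characteristic time.** For $z=\dot b(\theta')$ with $\theta'\in\Theta$ let ${\rm KL}(x,z)=\sup_{\eta\in\Theta}(\eta x-b(\eta))-(\theta'x-b(\theta'))$, and let ${\rm KL}(x,x)=0$; if $x=\dot b(\theta)$ with $\theta\in\Theta$, this is the Kullback–Leibler divergence $b(\theta')-b(\theta)-\dot b(\theta)(\theta'-\theta)$ of $\nu_\theta$ from $\nu_{\theta'}$. For $\alpha\in[0,1]$ and $z=\alpha x+(1-\alpha)y$ put $I_\alpha(x,y)=\alpha{\rm KL}(x,z)+(1-\alpha){\rm KL}(y,z)$. For $\omega$ in the simplex $\Delta(V)$ and $m=G^\top\omega$ let $$T(\omega;\nu)^{-1}=\min_{u\ne a^\star}(m_u+m_{a^\star})\,I_{\frac{m_{a^\star}}{m_u+m_{a^\star}}}(\mu_{a^\star},\mu_u),\qquad T^\star(\nu)^{-1}=\sup_{\omega\in\Delta(V)}T(\omega;\nu)^{-1}.$$ **Algorithm TaS-FG.** Let $N_v(t)$ be the number of rounds $n\le t$ with $V_n=v$, and $N_{v,u}(t)$ the number of those in which a reward of $u$ was observed ($u\in E_n$ in the informed case, $Z_{n,u}\neq0$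 in the uninformed case). Let $M_u(t)=\sum_vN_{v,u}(t)$, $\hat\mu_u(t)=\frac1{M_u(t)}\sum_{n\le t}Z_{n,u}$, $\hat G_{v,u}(t)=N_{v,u}(t)/N_v(t)$ (or $\hat G(t)=G$ if $G$ is known), $\hat\nu(t)=(\hat G(t),\hat\mu(t))$. Let $\omega^\star(t)\in\arg\min_{\omega\in\Delta(V)}T(\omega;\hat\nu(t))$ once all $M_u(t)>0$, and let $\omega^\star(t)\in\Delta(V)$ be arbitrary before. With $S_t=\{u:N_u(t)<\sqrt t-K/2\}$, the averaged D-tracking rule chooses, measurably with respect to the observations up to time $t$ and with arbitrary tie-breaking, $$V_{t+1}\in\arg\min_{u\in S_t}N_u(t)\ \text{ if }S_t\neq\emptyset,\qquad V_{t+1}\in\arg\min_{u\in V}\Big(N_u(t)-\sum_{n=1}^t\omega^\star_u(n)\Big)\ \text{ otherwise.}$$ The stopping time is $\tau=\tau_\delta=\inf\{t\ge1:L(t)\ge\beta(t,\delta)\}$, where $L(t)=t\,T(N(t)/t;\hat\nu(t))^{-1}$ (and $L(t)=0$ while some $M_u(t)=0$) and $$\beta(t,\delta)=2\,\mathcal C_{\rm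 exp}\Big(\tfrac12\ln\tfrac{K-1}{\delta}\Big)+6\ln(1+\ln t).$$ Here $\mathcal C_{\rm exp}(x)=2\tilde h_{3/2}\big(\tfrac12(h^{-1}(1+x)+\ln(2\zeta(2)))\big)$, $h(u)=u-\ln u$ on $[1,\infty)$, and $\tilde h_z(x)=h^{-1}(x)e^{1/h^{-1}(x)}$ if $x\ge h(1/\ln z)$, $\tilde h_z(x)=z(x-\ln\ln z)$ otherwise. **Theorem.** For every such model $\nu$, TaS-FG satisfies: 1. for all $\delta\in(0,1/2)$, $\mathbb P_\nu(\tau_\delta<\infty)=1$; 2. $\mathbb P_\nu\big(\limsup_{\delta\to0}\tau_\delta/\ln(1/\delta)\le T^\star(\nu)\big)=1$; 3. $\limsup_{\delta\to0}\mathbb E_\nu[\tau_\delta]/\ln(1/\delta)\le T^\star(\nu)$. -/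

import Mathlib

open MeasureTheory ProbabilityTheory Filter Topology
open scoped ENNReal

namespace FeedbackBAI

/-! ### One-parameter canonical exponential families -/

/-- The log-partition function `b(θ) = log ∫ exp (θ x) dρ(x)` of the family dominated by `ρ`. -/
noncomputable def logPartition (ρ : Measure ℝ) (θ : ℝ) : ℝ := cgf id ρ θ

/-- The (open) set `Θ` of canonical parameters: the interior of `{θ | ∫ exp (θ x) dρ(x) < ∞}`. -/
def paramSpace (ρ : Measure ℝ) : Set ℝ := interior (integrableExpSet id ρ)

/-- The member `ν_θ` of the family: `dν_θ / dρ (x) = exp (θ x - b(θ))`. -/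
noncomputable def expFamily (ρ : Measure ℝ) (θ : ℝ) : Measure ℝ :=
  ρ.withDensity (fun x => ENNReal.ofReal (Real.exp (θ * x - logPartition ρ θ)))

/-- The maximal log-likelihood per observation `sup_{θ ∈ Θ} (θ x - b(θ))` when the empirical mean
is `x`. For `x = b'(θ)` with `θ ∈ Θ` it equals `θ x - b(θ)`; it is also the natural value at an
empirical mean on the boundary of the mean space (e.g. only zeros seen from a Bernoulli arm). -/
noncomputable def maxLogLik (ρ : Measure ℝ) (x : ℝ) : ℝ :=
  ⨆ θ : paramSpace ρ, ((θ : ℝ) * x - logPartition ρ θ)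

/-- The canonical parameter `θ ∈ Θ` whose mean `b'(θ)` is `z`. -/
noncomputable def canonicalParam (ρ : Measure ℝ) (z : ℝ) : ℝ :=
  Function.invFunOn (deriv (logPartition ρ)) (paramSpace ρ) z

/-- The divergence `KL` between the members of the family with means `x` and `z`, as a function of
the means. With `x = b'(θ)` and `z = b'(θ')` it reads `b(θ') - b(θ) - b'(θ) (θ' - θ)`. -/
noncomputable def klMean (ρ : Measure ℝ) (x z : ℝ) : ℝ :=
  maxLogLik ρ x - maxLogLik ρ z - canonicalParam ρ z * (x - z)

/-- The generalized Jensen-Shannon divergence `I_α` of the members with means `x` and `y`; the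
mixture is the member of the family with mean `α x + (1 - α) y`. -/
noncomputable def jensenShannon (ρ : Measure ℝ) (α x y : ℝ) : ℝ :=
  α * klMean ρ x (α * x + (1 - α) * y) + (1 - α) * klMean ρ y (α * x + (1 - α) * y)

/-! ### Models and the characteristic time -/

section Model

variable {V : Type*} [Fintype V] [Nontrivial V]

/-- A vertex with the largest value. -/
noncomputable def bestArm (μ : V → ℝ) : V := Classical.choose (Finite.exists_max μ)

/-- The observation rates `m = Gᵀ ω`. -/
def obsRate (G : V → V → ℝ) (ω : V → ℝ) (u : V) : ℝ := ∑ v, ω v * G v u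

/-- `T(ω; ν)⁻¹` for the model with graph `G` and means `μ`. -/
noncomputable def infoRate (ρ : Measure ℝ) (G : V → V → ℝ) (μ ω : V → ℝ) : ℝ :=
  ⨅ u : {u : V // u ≠ bestArm μ},
    (obsRate G ω u + obsRate G ω (bestArm μ)) *
      jensenShannon ρ (obsRate G ω (bestArm μ) / (obsRate G ω u + obsRate G ω (bestArm μ)))
        (μ (bestArm μ)) (μ u)

/-- The characteristic time `T⋆(ν)`, defined by `T⋆(ν)⁻¹ = sup_{ω ∈ Δ(V)} T(ω; ν)⁻¹`. -/
noncomputable def charTime (ρ : Measure ℝ) (G : V → V → ℝ) (μ : V → ℝ) : ℝ :=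
  (⨆ ω : stdSimplex ℝ V, infoRate ρ G μ ω)⁻¹

/-- The set of optimal allocations, i.e. of the minimizers of `T(ω; ν)` over `Δ(V)`. -/
def optAlloc (ρ : Measure ℝ) (G : V → V → ℝ) (μ : V → ℝ) : Set (V → ℝ) :=
  {ω | ω ∈ stdSimplex ℝ V ∧ ∀ ω' ∈ stdSimplex ℝ V, infoRate ρ G μ ω' ≤ infoRate ρ G μ ω}

/-- A bandit model with a stochastic feedback graph: choosing `v` reveals a reward of `u` with
probability `G v u`; the rewards of `u` have law `ν_{θ u}`. Every vertex is observable and the best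
vertex is unique. -/
structure Model (V : Type*) where
  /-- dominating measure of the exponential family -/
  ρ : Measure ℝ
  /-- edge activation probabilities -/
  G : V → V → ℝ
  /-- canonical parameters of the arms -/
  θ : V → ℝ
  weight_mem : ∀ v u, G v u ∈ Set.Icc (0 : ℝ) 1
  observable : ∀ u, ∃ v, 0 < G v u
  param_mem : ∀ u, θ u ∈ paramSpace ρ
  unique_best : ∃ a, ∀ u, u ≠ a → ∫ x, x ∂(expFamily ρ (θ u)) < ∫ x, x ∂(expFamily ρ (θ a))

/-- The mean reward of a vertex. -/
noncomputable def Model.mean (ν : Model V) (u : V) : ℝ := ∫ x, x ∂(expFamily ν.ρ (ν.θ u))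

/-- The characteristic time of a model. -/
noncomputable def Model.charTime (ν : Model V) : ℝ := FeedbackBAI.charTime ν.ρ ν.G ν.mean

end Model

/-! ### Interaction -/

/-- What the learner sees besides the feedback `Z`. -/
inductive Setting where
  /-- neither the graph nor the activated edges are known -/
  | uninformed
  /-- the activated edges are revealed in every round, the graph is unknown -/
  | informed
  /-- the activated edges are revealed in every round, and the graph is known in advance -/
  | informedKnownGraph

section Interaction

variable {V Ω : Type*}

/-- The random variables of an interaction; rounds are numbered `1, 2, …` (index `0` is unused).
`act n` is the vertex chosen in round `n`, `edge n v u ∈ {0, 1}` the activation of the edge `(v, u)`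
and `rew n u` the reward of `u` in that round. -/
structure Run (V Ω : Type*) where
  act : ℕ → Ω → V
  edge : ℕ → V → V → Ω → ℝ
  rew : ℕ → V → Ω → ℝ

/-- The feedback `Z_{n,u} = Y_{n,(V_n,u)} R_{n,u}`. -/
def Run.feedback (r : Run V Ω) (n : ℕ) (u : V) (s : Ω) : ℝ :=
  r.edge n (r.act n s) u s * r.rew n u s

/-- The information in round `n`: `σ(V_n, Z_n)`, and `σ(V_n, E_n, Z_n)` in the informed case. -/
abbrev Run.roundInfo [MeasurableSpace V] (r : Run V Ω) (σ : Setting) (n : ℕ) : MeasurableSpace Ω :=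
  MeasurableSpace.comap (r.act n) inferInstance ⊔
  (⨆ u, MeasurableSpace.comap (r.feedback n u) inferInstance) ⊔
  (match σ with
    | .uninformed => ⊥
    | _ => ⨆ u, MeasurableSpace.comap (fun s => r.edge n (r.act n s) u s) inferInstance)

/-- The history `ℱ_t` of the rounds `1, …, t`. -/
abbrev Run.history [MeasurableSpace V] (r : Run V Ω) (σ : Setting) (t : ℕ) : MeasurableSpace Ω :=
  ⨆ n ∈ Finset.Icc 1 t, r.roundInfo σ n

/-- `r` is an interaction of some non-anticipating sampling rule with the model `ν`: all edge
activations and rewards are independent, with laws `Ber(G_{v,u})` and `ν_u`, and `V_{t+1}` is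
`ℱ_t`-measurable. -/
structure Run.IsInteraction [MeasurableSpace V] [MeasurableSpace Ω] (r : Run V Ω) (ν : Model V)
    (σ : Setting) (P : Measure Ω) : Prop where
  measurable_edge : ∀ n v u, Measurable (r.edge n v u)
  measurable_rew : ∀ n u, Measurable (r.rew n u)
  edge_zero_or_one : ∀ n v u s, r.edge n v u s = 0 ∨ r.edge n v u s = 1
  edge_law : ∀ n v u, P {s | r.edge n v u s = 1} = ENNReal.ofReal (ν.G v u)
  rew_law : ∀ n u, P.map (r.rew n u) = expFamily ν.ρ (ν.θ u)
  indep : iIndepFun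
    (fun i : ℕ × (V × V ⊕ V) =>
      Sum.elim (fun e : V × V => r.edge i.1 e.1 e.2) (fun u : V => r.rew i.1 u) i.2) P
  adapted : ∀ t, Measurable[r.history σ t] (r.act (t + 1))

/-! ### Estimates -/

/-- The event, as seen by the learner, that a reward of `u` was observed in round `n`. Without
information on the edges, nonzero feedback is what is counted. -/
def Run.Observed (r : Run V Ω) (σ : Setting) (n : ℕ) (u : V) (s : Ω) : Prop :=
  match σ with
  | .uninformed => r.feedback n u s ≠ 0
  | _ => r.edge n (r.act n s) u s = 1

open Classical in
/-- `N_v(t)`. -/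
noncomputable def Run.visits (r : Run V Ω) (t : ℕ) (s : Ω) (v : V) : ℝ :=
  ∑ n ∈ Finset.Icc 1 t, if r.act n s = v then 1 else 0

open Classical in
/-- `N_{v,u}(t)`. -/
noncomputable def Run.edgeCount (r : Run V Ω) (σ : Setting) (t : ℕ) (s : Ω) (v u : V) : ℝ :=
  ∑ n ∈ Finset.Icc 1 t, if r.act n s = v ∧ r.Observed σ n u s then 1 else 0

/-- The estimated graph: `N_{v,u}(t) / N_v(t)`, or the graph itself if it is known. -/
noncomputable def Run.graphEst (r : Run V Ω) (ν : Model V) (σ : Setting) (t : ℕ) (s : Ω)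
    (v u : V) : ℝ :=
  match σ with
  | .informedKnownGraph => ν.G v u
  | _ => r.edgeCount σ t s v u / r.visits t s v

variable [Fintype V]

/-- `M_u(t) = ∑_v N_{v,u}(t)`. -/
noncomputable def Run.obsCount (r : Run V Ω) (σ : Setting) (t : ℕ) (s : Ω) (u : V) : ℝ :=
  ∑ v, r.edgeCount σ t s v u

/-- The empirical mean of the observed rewards of `u`. -/
noncomputable def Run.meanEst (r : Run V Ω) (σ : Setting) (t : ℕ) (s : Ω) (u : V) : ℝ :=
  (∑ n ∈ Finset.Icc 1 t, r.feedback n u s) / r.obsCount σ t s u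

/-! ### The algorithm -/

/-- Averaged D-tracking of the plug-in optimal allocations `w t`. Until every vertex has been
observed (so that `μ̂(t)` is defined), `w t` may be any element of the simplex. -/
structure Run.IsAveragedDTracking [Nontrivial V] [MeasurableSpace Ω] (r : Run V Ω) (ν : Model V)
    (σ : Setting) (P : Measure Ω) (w : ℕ → Ω → V → ℝ) : Prop where
  mem_simplex : ∀ᵐ s ∂P, ∀ t, w t s ∈ stdSimplex ℝ V
  optimal : ∀ᵐ s ∂P, ∀ t, (∀ u, 0 < r.obsCount σ t s u) →
    w t s ∈ optAlloc ν.ρ (r.graphEst ν σ t s) (r.meanEst σ t s)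
  forced : ∀ᵐ s ∂P, ∀ t, (∃ u, r.visits t s u < √t - Fintype.card V / 2) →
    r.visits t s (r.act (t + 1) s) < √t - Fintype.card V / 2 ∧
    ∀ u, r.visits t s u < √t - Fintype.card V / 2 →
      r.visits t s (r.act (t + 1) s) ≤ r.visits t s u
  tracking : ∀ᵐ s ∂P, ∀ t, (¬ ∃ u, r.visits t s u < √t - Fintype.card V / 2) →
    ∀ u, r.visits t s (r.act (t + 1) s) - ∑ n ∈ Finset.Icc 1 t, w n s (r.act (t + 1) s) ≤
      r.visits t s u - ∑ n ∈ Finset.Icc 1 t, w n s u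

open Classical in
/-- The statistic `L(t) = t T(N(t)/t; ν̂(t))⁻¹`, and `0` as long as some vertex is unobserved. -/
noncomputable def Run.glr [Nontrivial V] (r : Run V Ω) (ν : Model V) (σ : Setting) (t : ℕ)
    (s : Ω) : ℝ :=
  if ∀ u, 0 < r.obsCount σ t s u then
    t * infoRate ν.ρ (r.graphEst ν σ t s) (r.meanEst σ t s) (fun v => r.visits t s v / t)
  else 0

end Interaction

/-! ### Threshold and stopping time -/

/-- `h(u) = u - log u`. -/
noncomputable def hFun (u : ℝ) : ℝ := u - Real.log u

/-- The inverse of `h` on `[1, ∞)`. -/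
noncomputable def hInv (x : ℝ) : ℝ := Function.invFunOn hFun (Set.Ici 1) x

open Classical in
/-- The function `h̃_z`. -/
noncomputable def hTilde (z x : ℝ) : ℝ :=
  if hFun (1 / Real.log z) ≤ x then hInv x * Real.exp (1 / hInv x)
  else z * (x - Real.log (Real.log z))

/-- The function `C_exp`. -/
noncomputable def cExp (x : ℝ) : ℝ :=
  2 * hTilde (3 / 2) ((hInv (1 + x) + Real.log (2 * (riemannZeta 2).re)) / 2)

/-- The threshold `β(t, δ)` for `K` vertices. -/
noncomputable def threshold (K t : ℕ) (δ : ℝ) : ℝ :=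
  2 * cExp (Real.log (((K : ℝ) - 1) / δ) / 2) + 6 * Real.log (1 + Real.log t)

/-- The stopping time `τ = inf {t ≥ 1 | L(t) ≥ β(t, δ)}`, with `inf ∅ = ∞`. -/
noncomputable def Run.stopTime {V Ω : Type*} [Fintype V] [Nontrivial V] (r : Run V Ω) (ν : Model V)
    (σ : Setting) (δ : ℝ) (s : Ω) : ℕ∞ :=
  ⨅ t ∈ {t : ℕ | 1 ≤ t ∧ threshold (Fintype.card V) t δ ≤ r.glr ν σ t s}, (t : ℕ∞)

end FeedbackBAI

/-!
Write `f = maxLogLik ρ` for the convex conjugate of the log-partition function `b`. The terms of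
the Jensen-Shannon divergence that contain the canonical parameter of the mixture cancel, and
`(p + q) I_{p/(p+q)}(x, y) = p f(x) + q f(y) - (p + q) f((p x + q y) / (p + q))` is the minimum
over `θ ∈ Θ` of `p (f(x) - θ x + b(θ)) + q (f(y) - θ y + b(θ))` (`pairInfo_le`,
`exists_pairInfo_eq`). As a minimum of functions that are linear in the rates, `T(ω; ν)⁻¹` is
concave in `ω` (`concaveOn_infoMin`); it is jointly continuous in graph, means and allocation,
and near the true model it is close to its true value uniformly in `ω`
(`infoRate_uniform_approx`).

Averaged D-tracking satisfies two pathwise bounds. Forced exploration gives every vertex at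
least `√t - K - 2` visits, where `K` is the number of vertices (`sqrt_sub_le_visits`), and the
visits stay within `K (√t + 1)` of the sum of the plug-in allocations
(`abs_visits_sub_target_le`). Hence, if all estimates after time `n₀` are accurate, then
concavity and continuity give `L(t) ≥ κ t - n₀ / T⋆` for every `κ < 1 / T⋆` and all large `t`
(`Model.exists_glr_ge`). Since the threshold is `ln (1 / δ)` to first order in `δ` and sublinear
in `t`, this yields `τ_δ ≤ (1 + o(1)) ln (1 / δ) / κ + C (n₀ + 1)` (`Model.exists_stopTime_le`).

All three claims follow once `n₀` is integrable. For a one-sided deviation of an estimate there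
is a nonnegative supermartingale, the exponential of a sum of independent increments selected by
the sampling rule (`Run.IsInteraction.lintegral_prod_le_one`), that is exponentially large in
the number of samples on the event of the deviation. Markov's inequality and the lower bound on
the number of visits show that an estimate at time `t` is inaccurate with probability at most
`exp (-c √t)` up to a factor, and `∑ t exp (-c √t)` converges
(`Run.IsInteraction.lastTimeIntegrable_not_accurate`).
-/

namespace FeedbackBAI

/-! ### Convex duality for the exponential family -/

section ExpFamily

variable {ρ : Measure ℝ}

lemma isOpen_paramSpace (ρ : Measure ℝ) : IsOpen (paramSpace ρ) := isOpen_interior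

lemma convex_paramSpace (ρ : Measure ℝ) : Convex ℝ (paramSpace ρ) :=
  convex_integrableExpSet.interior

lemma integrable_exp_of_mem_paramSpace {θ : ℝ} (hθ : θ ∈ paramSpace ρ) :
    Integrable (fun x => Real.exp (θ * id x)) ρ :=
  interior_subset (s := integrableExpSet id ρ) hθ

lemma expFamily_eq_tilted {θ : ℝ} (hθ : θ ∈ paramSpace ρ) :
    expFamily ρ θ = ρ.tilted (fun x => θ * id x) := by
  rcases eq_zero_or_neZero ρ with rfl | hρ
  · simp [expFamily]
  · unfold expFamily Measure.tilted logPartition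
    congr 1
    ext x
    rw [Real.exp_sub, exp_cgf (integrable_exp_of_mem_paramSpace hθ)]
    rfl

lemma integral_expFamily {θ : ℝ} (hθ : θ ∈ paramSpace ρ) :
    ∫ x, x ∂(expFamily ρ θ) = deriv (logPartition ρ) θ := by
  rw [expFamily_eq_tilted hθ]
  exact integral_tilted_mul_self (X := id) hθ

lemma differentiableAt_logPartition {θ : ℝ} (hθ : θ ∈ paramSpace ρ) :
    DifferentiableAt ℝ (logPartition ρ) θ :=
  (analyticAt_cgf (X := id) hθ).differentiableAt

lemma differentiableAt_deriv_logPartition {θ : ℝ} (hθ : θ ∈ paramSpace ρ) :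
    DifferentiableAt ℝ (deriv (logPartition ρ)) θ :=
  (analyticAt_cgf (X := id) hθ).deriv.differentiableAt

lemma deriv_deriv_logPartition {θ : ℝ} (hθ : θ ∈ paramSpace ρ) :
    deriv (deriv (logPartition ρ)) θ = Var[id; expFamily ρ θ] := by
  rw [expFamily_eq_tilted hθ, variance_tilted_mul (X := id) hθ, iteratedDeriv_succ,
    iteratedDeriv_one]
  rfl

/-- The tangent line of the log-partition function at `θ` lies below it. -/
lemma logPartition_tangent_le {θ η : ℝ} (hθ : θ ∈ paramSpace ρ) (hη : η ∈ paramSpace ρ) :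
    logPartition ρ θ + deriv (logPartition ρ) θ * (η - θ) ≤ logPartition ρ η := by
  have hconv : ConvexOn ℝ (paramSpace ρ) (logPartition ρ) := by
    have hint : interior (paramSpace ρ) = paramSpace ρ := (isOpen_paramSpace ρ).interior_eq
    refine convexOn_of_deriv2_nonneg (convex_paramSpace ρ)
      (fun x hx => (differentiableAt_logPartition hx).continuousAt.continuousWithinAt)
      ?_ ?_ ?_
    · rw [hint]
      exact fun x hx => (differentiableAt_logPartition hx).differentiableWithinAt
    · rw [hint]
      exact fun x hx => (differentiableAt_deriv_logPartition hx).differentiableWithinAt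
    · rw [hint]
      intro x hx
      have := deriv_deriv_logPartition hx
      simp only [Function.iterate_succ, Function.iterate_zero, Function.comp, id]
      rw [this]
      exact variance_nonneg _ _
  rcases lt_trichotomy θ η with h | h | h
  · have := hconv.deriv_le_slope hθ hη h (differentiableAt_logPartition hθ)
    rw [slope_def_field, le_div_iff₀ (by linarith)] at this
    linarith
  · simp [h]
  · have := hconv.slope_le_deriv hη hθ h (differentiableAt_logPartition hθ)
    rw [slope_def_field, div_le_iff₀ (by linarith)] at this
    linarith

/-- The mean space `b'(Θ)` of the family. -/
def meanSpace (ρ : Measure ℝ) : Set ℝ := deriv (logPartition ρ) '' paramSpace ρ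

lemma maxLogLik_deriv {θ : ℝ} (hθ : θ ∈ paramSpace ρ) :
    maxLogLik ρ (deriv (logPartition ρ) θ)
      = θ * deriv (logPartition ρ) θ - logPartition ρ θ := by
  have hle : ∀ η : paramSpace ρ, (η : ℝ) * deriv (logPartition ρ) θ - logPartition ρ η
      ≤ θ * deriv (logPartition ρ) θ - logPartition ρ θ := by
    intro η
    have := logPartition_tangent_le hθ η.2
    linarith
  have : Nonempty (paramSpace ρ) := ⟨⟨θ, hθ⟩⟩
  refine le_antisymm (ciSup_le hle) ?_
  exact le_ciSup (f := fun η : paramSpace ρ =>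
    (η : ℝ) * deriv (logPartition ρ) θ - logPartition ρ η)
    ⟨_, by rintro _ ⟨η, rfl⟩; exact hle η⟩ ⟨θ, hθ⟩

lemma le_maxLogLik {x η : ℝ} (hx : x ∈ meanSpace ρ) (hη : η ∈ paramSpace ρ) :
    η * x - logPartition ρ η ≤ maxLogLik ρ x := by
  obtain ⟨θ, hθ, rfl⟩ := hx
  rw [maxLogLik_deriv hθ]
  have := logPartition_tangent_le hθ hη
  linarith

/-- Equality in the Fenchel-Young inequality holds only at the mean parameter. -/
lemma eq_deriv_of_maxLogLik_eq {x η : ℝ} (hx : x ∈ meanSpace ρ) (hη : η ∈ paramSpace ρ)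
    (h : η * x - logPartition ρ η = maxLogLik ρ x) : x = deriv (logPartition ρ) η := by
  have hmax : IsLocalMax (fun ζ => ζ * x - logPartition ρ ζ) η := by
    filter_upwards [(isOpen_paramSpace ρ).mem_nhds hη] with ζ hζ
    rw [h]
    exact le_maxLogLik hx hζ
  have hd : HasDerivAt (fun ζ => ζ * x - logPartition ρ ζ) (1 * x - deriv (logPartition ρ) η) η :=
    ((hasDerivAt_id η).mul_const x).sub (differentiableAt_logPartition hη).hasDerivAt
  have := hmax.hasDerivAt_eq_zero hd
  linarith

lemma continuousOn_deriv_logPartition (ρ : Measure ℝ) :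
    ContinuousOn (deriv (logPartition ρ)) (paramSpace ρ) :=
  fun _ hx => (differentiableAt_deriv_logPartition hx).continuousAt.continuousWithinAt

lemma convex_meanSpace (ρ : Measure ℝ) : Convex ℝ (meanSpace ρ) :=
  ((convex_paramSpace ρ).isPreconnected.image _
    (continuousOn_deriv_logPartition ρ)).ordConnected.convex

/-- If two members of the family have different means, then no member is degenerate. -/
lemma strictMonoOn_deriv_logPartition {θ₁ θ₂ : ℝ} (h₁ : θ₁ ∈ paramSpace ρ)
    (h₂ : θ₂ ∈ paramSpace ρ)
    (hne : deriv (logPartition ρ) θ₁ ≠ deriv (logPartition ρ) θ₂) :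
    StrictMonoOn (deriv (logPartition ρ)) (paramSpace ρ) := by
  refine strictMonoOn_of_deriv_pos (convex_paramSpace ρ) (continuousOn_deriv_logPartition ρ) ?_
  rw [(isOpen_paramSpace ρ).interior_eq]
  intro θ hθ
  rw [deriv_deriv_logPartition hθ]
  refine lt_of_le_of_ne (variance_nonneg _ _) fun h0 => hne ?_
  have hρ : NeZero ρ := ⟨by
    rintro rfl
    exact hne (by simp [← integral_expFamily h₁, ← integral_expFamily h₂, expFamily])⟩
  have hprob : ∀ {ζ}, ζ ∈ paramSpace ρ → IsProbabilityMeasure (ρ.tilted (fun x => ζ * id x)) :=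
    fun hζ => isProbabilityMeasure_tilted (integrable_exp_of_mem_paramSpace hζ)
  have := hprob hθ
  rw [expFamily_eq_tilted hθ] at h0
  have hae := ae_eq_integral_of_variance_eq_zero (memLp_tilted_mul (X := id) hθ 2) h0.symm
  have hae' := (absolutelyContinuous_tilted (integrable_exp_of_mem_paramSpace hθ)).ae_eq hae
  -- A degenerate member makes `ρ` a point mass up to a factor, hence all members have its mean.
  have hconst : ∀ {ζ}, ζ ∈ paramSpace ρ → deriv (logPartition ρ) ζ
      = ∫ x, id x ∂(ρ.tilted (fun x => θ * id x)) := by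
    intro ζ hζ
    have := hprob hζ
    rw [← integral_expFamily hζ, expFamily_eq_tilted hζ]
    have h2 := (tilted_absolutelyContinuous ρ (fun x => ζ * id x)).ae_eq hae'
    refine (integral_congr_ae h2).trans ?_
    rw [integral_const, probReal_univ, one_smul]
  rw [hconst h₁, hconst h₂]

lemma isOpen_meanSpace (hmono : StrictMonoOn (deriv (logPartition ρ)) (paramSpace ρ)) :
    IsOpen (meanSpace ρ) := by
  rw [isOpen_iff_mem_nhds]
  rintro _ ⟨θ, hθ, rfl⟩
  obtain ⟨ε, hε, hball⟩ := Metric.isOpen_iff.1 (isOpen_paramSpace ρ) θ hθ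
  have hl : θ - ε / 2 ∈ paramSpace ρ := hball (by
    rw [Metric.mem_ball, Real.dist_eq, abs_lt]; constructor <;> linarith)
  have hr : θ + ε / 2 ∈ paramSpace ρ := hball (by
    rw [Metric.mem_ball, Real.dist_eq, abs_lt]; constructor <;> linarith)
  refine mem_of_superset (Ioo_mem_nhds (hmono hl hθ (by linarith)) (hmono hθ hr (by linarith))) ?_
  exact Set.Ioo_subset_Icc_self.trans
    ((convex_meanSpace ρ).ordConnected.out ⟨_, hl, rfl⟩ ⟨_, hr, rfl⟩)

lemma convexOn_maxLogLik (ρ : Measure ℝ) : ConvexOn ℝ (meanSpace ρ) (maxLogLik ρ) := by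
  refine ⟨convex_meanSpace ρ, fun x hx y hy a b ha hb hab => ?_⟩
  obtain ⟨θ, hθ, hz⟩ := convex_meanSpace ρ hx hy ha hb hab
  rw [← hz, maxLogLik_deriv hθ, hz]
  have h1 := mul_le_mul_of_nonneg_left (le_maxLogLik hx hθ) ha
  have h2 := mul_le_mul_of_nonneg_left (le_maxLogLik hy hθ) hb
  simp only [smul_eq_mul]
  have : logPartition ρ θ = a * logPartition ρ θ + b * logPartition ρ θ := by
    rw [← add_mul, hab, one_mul]
  linarith

lemma continuousOn_maxLogLik (hmono : StrictMonoOn (deriv (logPartition ρ)) (paramSpace ρ)) :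
    ContinuousOn (maxLogLik ρ) (meanSpace ρ) :=
  (convexOn_maxLogLik ρ).continuousOn (isOpen_meanSpace hmono)

end ExpFamily

/-! ### The information of a pair of arms -/

section PairInfo

variable {ρ : Measure ℝ}

/-- The information for separating means `x` and `y` that are observed at rates `p` and `q`. -/
noncomputable def pairInfo (ρ : Measure ℝ) (p q x y : ℝ) : ℝ :=
  (q + p) * jensenShannon ρ (p / (q + p)) x y

/-- The deviance of the parameter `θ` at the empirical mean `x`. -/
noncomputable def deviance (ρ : Measure ℝ) (x θ : ℝ) : ℝ :=
  maxLogLik ρ x - (θ * x - logPartition ρ θ)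

lemma deviance_nonneg {x θ : ℝ} (hx : x ∈ meanSpace ρ) (hθ : θ ∈ paramSpace ρ) :
    0 ≤ deviance ρ x θ := sub_nonneg.2 (le_maxLogLik hx hθ)

/-- The terms of the divergence that involve the canonical parameter of the mixture cancel. -/
lemma pairInfo_eq {p q : ℝ} (x y : ℝ) (h : q + p ≠ 0) :
    pairInfo ρ p q x y = p * maxLogLik ρ x + q * maxLogLik ρ y
      - (q + p) * maxLogLik ρ ((p * x + q * y) / (q + p)) := by
  have hz : p / (q + p) * x + (1 - p / (q + p)) * y = (p * x + q * y) / (q + p) := by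
    field_simp
    ring
  unfold pairInfo jensenShannon klMean
  rw [hz]
  field_simp
  ring

lemma mix_mem_meanSpace {p q x y : ℝ} (hp : 0 ≤ p) (hq : 0 ≤ q) (h : 0 < q + p)
    (hx : x ∈ meanSpace ρ) (hy : y ∈ meanSpace ρ) :
    (p * x + q * y) / (q + p) ∈ meanSpace ρ := by
  have := convex_meanSpace ρ hx hy (div_nonneg hp h.le) (div_nonneg hq h.le)
    (by field_simp; ring)
  convert this using 1
  simp only [smul_eq_mul]
  field_simp

lemma pairInfo_le {p q x y θ : ℝ} (hp : 0 ≤ p) (hq : 0 ≤ q)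
    (hx : x ∈ meanSpace ρ) (hy : y ∈ meanSpace ρ) (hθ : θ ∈ paramSpace ρ) :
    pairInfo ρ p q x y ≤ p * deviance ρ x θ + q * deviance ρ y θ := by
  rcases (add_nonneg hq hp).eq_or_lt with h | h
  · have hp0 : p = 0 := by linarith
    have hq0 : q = 0 := by linarith
    simp [pairInfo, hp0, hq0]
  · rw [pairInfo_eq x y h.ne']
    have := mul_le_mul_of_nonneg_left (le_maxLogLik (mix_mem_meanSpace hp hq h hx hy) hθ) h.le
    have hz : (q + p) * ((p * x + q * y) / (q + p)) = p * x + q * y := by field_simp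
    have e : (q + p) * (θ * ((p * x + q * y) / (q + p)) - logPartition ρ θ)
      = θ * (p * x + q * y) - (q + p) * logPartition ρ θ := by linear_combination θ * hz
    rw [e] at this
    unfold deviance
    linarith

/-- `pairInfo` is the minimum over `θ` of functions that are linear in the rates. -/
lemma exists_pairInfo_eq {p q x y : ℝ} (hp : 0 ≤ p) (hq : 0 ≤ q)
    (hx : x ∈ meanSpace ρ) (hy : y ∈ meanSpace ρ) :
    ∃ θ ∈ paramSpace ρ, pairInfo ρ p q x y = p * deviance ρ x θ + q * deviance ρ y θ := by
  rcases (add_nonneg hq hp).eq_or_lt with h | h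
  · have hp0 : p = 0 := by linarith
    have hq0 : q = 0 := by linarith
    obtain ⟨θ, hθ, -⟩ := hx
    exact ⟨θ, hθ, by simp [pairInfo, hp0, hq0]⟩
  · obtain ⟨θ, hθ, hz'⟩ := mix_mem_meanSpace hp hq h hx hy
    refine ⟨θ, hθ, ?_⟩
    rw [pairInfo_eq x y h.ne', ← hz', maxLogLik_deriv hθ, hz']
    have hz : (q + p) * ((p * x + q * y) / (q + p)) = p * x + q * y := by field_simp
    have e : (q + p) * (θ * ((p * x + q * y) / (q + p)) - logPartition ρ θ)
      = θ * (p * x + q * y) - (q + p) * logPartition ρ θ := by linear_combination θ * hz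
    rw [e]
    unfold deviance
    ring

lemma pairInfo_nonneg {p q x y : ℝ} (hp : 0 ≤ p) (hq : 0 ≤ q)
    (hx : x ∈ meanSpace ρ) (hy : y ∈ meanSpace ρ) : 0 ≤ pairInfo ρ p q x y := by
  obtain ⟨θ, hθ, h⟩ := exists_pairInfo_eq hp hq hx hy
  rw [h]
  exact add_nonneg (mul_nonneg hp (deviance_nonneg hx hθ)) (mul_nonneg hq (deviance_nonneg hy hθ))

lemma pairInfo_pos {p q x y : ℝ} (hp : 0 < p) (hq : 0 < q)
    (hx : x ∈ meanSpace ρ) (hy : y ∈ meanSpace ρ) (hxy : x ≠ y) : 0 < pairInfo ρ p q x y := by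
  obtain ⟨θ, hθ, h⟩ := exists_pairInfo_eq hp.le hq.le hx hy
  refine lt_of_le_of_ne (pairInfo_nonneg hp.le hq.le hx hy) fun h0 => hxy ?_
  rw [h] at h0
  have h1 := deviance_nonneg hx hθ
  have h2 := deviance_nonneg hy hθ
  have h3 : deviance ρ x θ = 0 := by nlinarith [mul_nonneg hp.le h1, mul_nonneg hq.le h2]
  have h4 : deviance ρ y θ = 0 := by nlinarith [mul_nonneg hp.le h1, mul_nonneg hq.le h2]
  rw [eq_deriv_of_maxLogLik_eq hx hθ (sub_eq_zero.1 h3).symm,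
    eq_deriv_of_maxLogLik_eq hy hθ (sub_eq_zero.1 h4).symm]

lemma pairInfo_concave {p q p' q' a b x y : ℝ} (hp : 0 ≤ p) (hq : 0 ≤ q) (hp' : 0 ≤ p')
    (hq' : 0 ≤ q') (ha : 0 ≤ a) (hb : 0 ≤ b)
    (hx : x ∈ meanSpace ρ) (hy : y ∈ meanSpace ρ) :
    a * pairInfo ρ p q x y + b * pairInfo ρ p' q' x y
      ≤ pairInfo ρ (a * p + b * p') (a * q + b * q') x y := by
  obtain ⟨θ, hθ, h⟩ := exists_pairInfo_eq (p := a * p + b * p') (q := a * q + b * q')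
    (by positivity) (by positivity) hx hy
  rw [h]
  have h1 := mul_le_mul_of_nonneg_left (pairInfo_le hp hq hx hy hθ) ha
  have h2 := mul_le_mul_of_nonneg_left (pairInfo_le hp' hq' hx hy hθ) hb
  linarith

/-- Joint continuity, including the rates `p = q = 0`, where `pairInfo` is squeezed between `0` and
a linear function of the rates. -/
lemma continuousOn_pairInfo (hmono : StrictMonoOn (deriv (logPartition ρ)) (paramSpace ρ)) :
    ContinuousOn (fun z : (ℝ × ℝ) × (ℝ × ℝ) => pairInfo ρ z.1.1 z.1.2 z.2.1 z.2.2)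
      ((Set.Ici 0 ×ˢ Set.Ici 0) ×ˢ (meanSpace ρ ×ˢ meanSpace ρ)) := by
  rintro ⟨⟨p, q⟩, ⟨x, y⟩⟩ ⟨⟨hp, hq⟩, hx, hy⟩
  simp only [Set.mem_Ici] at hp hq hx hy
  have hf : ∀ x ∈ meanSpace ρ, ContinuousAt (maxLogLik ρ) x := fun x hx =>
    (continuousOn_maxLogLik hmono).continuousAt ((isOpen_meanSpace hmono).mem_nhds hx)
  have cx : Tendsto (fun z : (ℝ × ℝ) × (ℝ × ℝ) => z.2.1) (𝓝 ((p, q), (x, y))) (𝓝 x) :=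
    (continuous_fst.comp continuous_snd).tendsto _
  have cy : Tendsto (fun z : (ℝ × ℝ) × (ℝ × ℝ) => z.2.2) (𝓝 ((p, q), (x, y))) (𝓝 y) :=
    (continuous_snd.comp continuous_snd).tendsto _
  rcases (add_nonneg hq hp).eq_or_lt with h | h
  · have hp0 : p = 0 := by linarith
    have hq0 : q = 0 := by linarith
    subst hp0 hq0
    obtain ⟨θ, hθ, -⟩ := id hx
    have h0 : pairInfo ρ 0 0 x y = 0 := by simp [pairInfo]
    unfold ContinuousWithinAt
    simp only [h0]
    refine squeeze_zero' (g := fun z : (ℝ × ℝ) × (ℝ × ℝ) =>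
      z.1.1 * deviance ρ z.2.1 θ + z.1.2 * deviance ρ z.2.2 θ) ?_ ?_ ?_
    · filter_upwards [self_mem_nhdsWithin] with z hz
      exact pairInfo_nonneg hz.1.1 hz.1.2 hz.2.1 hz.2.2
    · filter_upwards [self_mem_nhdsWithin] with z hz
      exact pairInfo_le hz.1.1 hz.1.2 hz.2.1 hz.2.2 hθ
    · refine Tendsto.mono_left ?_ nhdsWithin_le_nhds
      have hx' : ContinuousAt (fun z : (ℝ × ℝ) × (ℝ × ℝ) => maxLogLik ρ z.2.1)
          (((0 : ℝ), (0 : ℝ)), (x, y)) :=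
        (hf x hx).tendsto.comp cx
      have hy' : ContinuousAt (fun z : (ℝ × ℝ) × (ℝ × ℝ) => maxLogLik ρ z.2.2)
          (((0 : ℝ), (0 : ℝ)), (x, y)) :=
        (hf y hy).tendsto.comp cy
      have : ContinuousAt (fun z : (ℝ × ℝ) × (ℝ × ℝ) =>
          z.1.1 * deviance ρ z.2.1 θ + z.1.2 * deviance ρ z.2.2 θ)
          (((0 : ℝ), (0 : ℝ)), (x, y)) := by
        unfold deviance
        fun_prop
      simpa [ContinuousAt] using this
  · refine ContinuousAt.continuousWithinAt ?_
    have hpos : ∀ᶠ z : (ℝ × ℝ) × (ℝ × ℝ) in 𝓝 ((p, q), (x, y)), 0 < z.1.2 + z.1.1 :=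
      continuousAt_const.eventually_lt
        (show ContinuousAt (fun z : (ℝ × ℝ) × (ℝ × ℝ) => z.1.2 + z.1.1) _ by fun_prop) h
    have hx' : ContinuousAt (fun z : (ℝ × ℝ) × (ℝ × ℝ) => maxLogLik ρ z.2.1) ((p, q), (x, y)) :=
      (hf x hx).tendsto.comp cx
    have hy' : ContinuousAt (fun z : (ℝ × ℝ) × (ℝ × ℝ) => maxLogLik ρ z.2.2) ((p, q), (x, y)) :=
      (hf y hy).tendsto.comp cy
    have hz' : ContinuousAt (fun z : (ℝ × ℝ) × (ℝ × ℝ) =>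
        maxLogLik ρ ((z.1.1 * z.2.1 + z.1.2 * z.2.2) / (z.1.2 + z.1.1))) ((p, q), (x, y)) := by
      refine ContinuousAt.comp (f := fun z : (ℝ × ℝ) × (ℝ × ℝ) =>
        (z.1.1 * z.2.1 + z.1.2 * z.2.2) / (z.1.2 + z.1.1))
        (hf _ (mix_mem_meanSpace hp hq h hx hy)) ?_
      exact ContinuousAt.div (by fun_prop) (by fun_prop) h.ne'
    have : ContinuousAt (fun z : (ℝ × ℝ) × (ℝ × ℝ) =>
        z.1.1 * maxLogLik ρ z.2.1 + z.1.2 * maxLogLik ρ z.2.2 - (z.1.2 + z.1.1) *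
          maxLogLik ρ ((z.1.1 * z.2.1 + z.1.2 * z.2.2) / (z.1.2 + z.1.1))) ((p, q), (x, y)) := by
      fun_prop
    refine this.congr ?_
    filter_upwards [hpos] with z hz
    exact (pairInfo_eq _ _ hz.ne').symm

end PairInfo

/-! ### The information rate as a function of graph, means and allocation -/

section InfoRate

variable {V : Type*} [Fintype V] {ρ : Measure ℝ}

/-- `T(ω; ν)⁻¹` for a model with best arm `a`. -/
noncomputable def infoMin (ρ : Measure ℝ) (a : V) (G : V → V → ℝ) (μ ω : V → ℝ) : ℝ :=
  ⨅ u : {u : V // u ≠ a}, pairInfo ρ (obsRate G ω a) (obsRate G ω u) (μ a) (μ u)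

lemma infoRate_eq_infoMin [Nontrivial V] {a : V} {μ : V → ℝ} (ha : ∀ u, u ≠ a → μ u < μ a)
    (G : V → V → ℝ) (ω : V → ℝ) : infoRate ρ G μ ω = infoMin ρ a G μ ω := by
  have h : bestArm μ = a := by
    by_contra hne
    exact absurd (Classical.choose_spec (Finite.exists_max μ) a) (not_le.2 (ha _ hne))
  subst h
  rfl

lemma obsRate_nonneg {G : V → V → ℝ} {ω : V → ℝ} (hG : ∀ v u, 0 ≤ G v u) (hω : ∀ v, 0 ≤ ω v)
    (u : V) : 0 ≤ obsRate G ω u :=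
  Finset.sum_nonneg fun v _ => mul_nonneg (hω v) (hG v u)

instance nonempty_ne [Nontrivial V] (a : V) : Nonempty {u : V // u ≠ a} := by
  obtain ⟨u, hu⟩ := exists_ne a
  exact ⟨⟨u, hu⟩⟩

lemma infoMin_nonneg [Nontrivial V] {a : V} {G : V → V → ℝ} {μ ω : V → ℝ}
    (hG : ∀ v u, 0 ≤ G v u) (hμ : ∀ u, μ u ∈ meanSpace ρ) (hω : ∀ v, 0 ≤ ω v) :
    0 ≤ infoMin ρ a G μ ω :=
  le_ciInf fun _ => pairInfo_nonneg (obsRate_nonneg hG hω _) (obsRate_nonneg hG hω _) (hμ _) (hμ _)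

lemma continuousOn_infoMin [Nontrivial V]
    (hmono : StrictMonoOn (deriv (logPartition ρ)) (paramSpace ρ)) (a : V) :
    ContinuousOn (fun z : (V → V → ℝ) × (V → ℝ) × (V → ℝ) => infoMin ρ a z.1 z.2.1 z.2.2)
      {z | (∀ v u, 0 ≤ z.1 v u) ∧ (∀ u, z.2.1 u ∈ meanSpace ρ) ∧ ∀ v, 0 ≤ z.2.2 v} := by
  classical
  unfold infoMin
  simp_rw [← Finset.inf'_univ_eq_ciInf]
  refine ContinuousOn.finset_inf'_apply _ fun u _ => ?_
  refine (continuousOn_pairInfo hmono).comp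
    (f := fun z : (V → V → ℝ) × (V → ℝ) × (V → ℝ) =>
      ((obsRate z.1 z.2.2 a, obsRate z.1 z.2.2 u), (z.2.1 a, z.2.1 u))) ?_ ?_
  · unfold obsRate
    fun_prop
  · rintro z ⟨h1, h2, h3⟩
    exact ⟨⟨obsRate_nonneg h1 h3 _, obsRate_nonneg h1 h3 _⟩, h2 _, h2 _⟩

lemma concaveOn_infoMin [Nontrivial V] {a : V} {G : V → V → ℝ} {μ : V → ℝ}
    (hG : ∀ v u, 0 ≤ G v u) (hμ : ∀ u, μ u ∈ meanSpace ρ) :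
    ConcaveOn ℝ (stdSimplex ℝ V) (infoMin ρ a G μ) := by
  refine ⟨convex_stdSimplex ℝ V, fun x hx y hy c d hc hd _ => ?_⟩
  refine le_ciInf fun u => ?_
  have hlin : ∀ v, obsRate G (c • x + d • y) v = c * obsRate G x v + d * obsRate G y v := by
    intro v
    simp only [obsRate, Pi.add_apply, Pi.smul_apply, smul_eq_mul, add_mul, Finset.sum_add_distrib,
      Finset.mul_sum, mul_assoc]
  rw [hlin, hlin]
  have hfin : ∀ z : V → ℝ, infoMin ρ a G μ z
      ≤ pairInfo ρ (obsRate G z a) (obsRate G z u) (μ a) (μ u) := fun z =>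
    ciInf_le (Set.finite_range _).bddBelow u
  refine le_trans (add_le_add (mul_le_mul_of_nonneg_left (hfin x) hc)
    (mul_le_mul_of_nonneg_left (hfin y) hd)) ?_
  exact pairInfo_concave (obsRate_nonneg hG hx.1 _) (obsRate_nonneg hG hx.1 _)
    (obsRate_nonneg hG hy.1 _) (obsRate_nonneg hG hy.1 _) hc hd (hμ _) (hμ _)

/-- The uniform allocation observes every vertex, so it separates the best arm from the others. -/
lemma exists_infoMin_pos [Nontrivial V] {a : V} {G : V → V → ℝ} {μ : V → ℝ}
    (hG : ∀ v u, 0 ≤ G v u) (hobs : ∀ u, ∃ v, 0 < G v u) (hμ : ∀ u, μ u ∈ meanSpace ρ)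
    (ha : ∀ u, u ≠ a → μ u < μ a) : ∃ ω ∈ stdSimplex ℝ V, 0 < infoMin ρ a G μ ω := by
  have hc : 0 < (Fintype.card V : ℝ) := by exact_mod_cast Fintype.card_pos
  refine ⟨fun _ => (Fintype.card V : ℝ)⁻¹, ⟨fun _ => by positivity, ?_⟩, ?_⟩
  · simp [Finset.sum_const, hc.ne']
  · have hm : ∀ u, 0 < obsRate G (fun _ => (Fintype.card V : ℝ)⁻¹) u := by
      intro u
      obtain ⟨v, hv⟩ := hobs u
      exact Finset.sum_pos' (fun w _ => mul_nonneg (by positivity) (hG w u))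
        ⟨v, Finset.mem_univ _, by positivity⟩
    obtain ⟨u, hu⟩ := exists_eq_ciInf_of_finite (f := fun u : {u : V // u ≠ a} =>
      pairInfo ρ (obsRate G (fun _ => (Fintype.card V : ℝ)⁻¹) a)
        (obsRate G (fun _ => (Fintype.card V : ℝ)⁻¹) u) (μ a) (μ u))
    unfold infoMin
    rw [← hu]
    exact pairInfo_pos (hm _) (hm _) (hμ _) (hμ _) (ha _ u.2).ne'

/-- Near the true graph and means, the information rate is close to the true one, uniformly over
the allocations. -/
lemma infoRate_uniform_approx [Nontrivial V]
    (hmono : StrictMonoOn (deriv (logPartition ρ)) (paramSpace ρ)) {a : V}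
    {G : V → V → ℝ} {μ : V → ℝ} (hG : ∀ v u, G v u ∈ Set.Icc (0 : ℝ) 1)
    (hμ : ∀ u, μ u ∈ meanSpace ρ) (ha : ∀ u, u ≠ a → μ u < μ a) {ε : ℝ} (hε : 0 < ε) :
    ∃ ξ > 0, ∀ G' : V → V → ℝ, ∀ μ' ω ω' : V → ℝ, (∀ v u, G' v u ∈ Set.Icc (0 : ℝ) 1) →
      (∀ v u, |G' v u - G v u| ≤ ξ) → (∀ u, |μ' u - μ u| ≤ ξ) →
      ω ∈ stdSimplex ℝ V → ω' ∈ stdSimplex ℝ V → (∀ u, |ω u - ω' u| ≤ ξ) →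
      |infoRate ρ G' μ' ω - infoRate ρ G μ ω'| ≤ ε := by
  have hopen : IsOpen {μ' : V → ℝ | (∀ u, μ' u ∈ meanSpace ρ) ∧ ∀ u, u ≠ a → μ' u < μ' a} := by
    simp only [Set.ofPred_and, Set.ofPred_forall]
    refine IsOpen.inter ?_ ?_
    · exact isOpen_iInter_of_finite fun u =>
        (isOpen_meanSpace hmono).preimage (continuous_apply u)
    · exact isOpen_iInter_of_finite fun u => isOpen_iInter_of_finite fun _ =>
        isOpen_lt (continuous_apply u) (continuous_apply a)
  obtain ⟨r, hr, hball⟩ := Metric.nhds_basis_closedBall.mem_iff.1 (hopen.mem_nhds ⟨hμ, ha⟩)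
  set K : Set ((V → V → ℝ) × (V → ℝ) × (V → ℝ)) :=
    (Set.univ.pi fun _ => Set.univ.pi fun _ => Set.Icc (0 : ℝ) 1) ×ˢ
      (Metric.closedBall μ r ×ˢ stdSimplex ℝ V) with hK
  have hcomp : IsCompact K :=
    (isCompact_univ_pi fun _ => isCompact_univ_pi fun _ => isCompact_Icc).prod
      ((isCompact_closedBall μ r).prod (isCompact_stdSimplex ℝ V))
  have hcont : ContinuousOn
      (fun z : (V → V → ℝ) × (V → ℝ) × (V → ℝ) => infoMin ρ a z.1 z.2.1 z.2.2) K :=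
    (continuousOn_infoMin hmono a).mono fun z hz =>
      ⟨fun v u => (hz.1 v trivial u trivial).1, (hball hz.2.1).1, hz.2.2.1⟩
  obtain ⟨d, hd, hunif⟩ := Metric.uniformContinuousOn_iff.1
    (hcomp.uniformContinuousOn_of_continuous hcont) ε hε
  refine ⟨min r (d / 2), lt_min hr (by linarith), ?_⟩
  intro G' μ' ω ω' hG' hGG hμμ hω hω' hωω
  have hμ' : μ' ∈ Metric.closedBall μ r := by
    rw [Metric.mem_closedBall, dist_pi_le_iff hr.le]
    exact fun u => (hμμ u).trans (min_le_left _ _)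
  have h1 : (G', μ', ω) ∈ K := ⟨fun v _ u _ => hG' v u, hμ', hω⟩
  have h2 : (G, μ, ω') ∈ K :=
    ⟨fun v _ u _ => hG v u, Metric.mem_closedBall_self hr.le, hω'⟩
  have hd2 : 0 ≤ d / 2 := by linarith
  have hdist : dist (G', μ', ω) (G, μ, ω') < d := by
    refine lt_of_le_of_lt ?_ (half_lt_self hd)
    simp only [Prod.dist_eq, max_le_iff]
    refine ⟨?_, ?_, ?_⟩
    · exact (dist_pi_le_iff hd2).2 fun v => (dist_pi_le_iff hd2).2 fun u =>
        (hGG v u).trans (min_le_right _ _)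
    · exact (dist_pi_le_iff hd2).2 fun u => (hμμ u).trans (min_le_right _ _)
    · exact (dist_pi_le_iff hd2).2 fun u => (hωω u).trans (min_le_right _ _)
  have := hunif _ h1 _ h2 hdist
  rw [infoRate_eq_infoMin (hball hμ').2, infoRate_eq_infoMin ha]
  exact this.le

lemma bddAbove_infoRate [Nontrivial V]
    (hmono : StrictMonoOn (deriv (logPartition ρ)) (paramSpace ρ)) {a : V}
    {G : V → V → ℝ} {μ : V → ℝ} (hG : ∀ v u, G v u ∈ Set.Icc (0 : ℝ) 1)
    (hμ : ∀ u, μ u ∈ meanSpace ρ) (ha : ∀ u, u ≠ a → μ u < μ a) :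
    BddAbove (Set.range fun ω : stdSimplex ℝ V => infoRate ρ G μ ω) := by
  have hcont : ContinuousOn (fun ω : V → ℝ => infoMin ρ a G μ ω) (stdSimplex ℝ V) :=
    (continuousOn_infoMin hmono a).comp (f := fun ω : V → ℝ => (G, μ, ω)) (by fun_prop)
      fun ω hω => ⟨fun v u => (hG v u).1, hμ, hω.1⟩
  obtain ⟨B, hB⟩ := (isCompact_stdSimplex ℝ V).bddAbove_image hcont
  refine ⟨B, ?_⟩
  rintro _ ⟨ω, rfl⟩
  simp only [infoRate_eq_infoMin ha]
  exact hB ⟨ω, ω.2, rfl⟩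

end InfoRate

/-! ### Deterministic properties of averaged D-tracking -/

section Tracking

variable {V Ω : Type*} (r : Run V Ω) (s : Ω)

lemma visits_zero (v : V) : r.visits 0 s v = 0 := by simp [Run.visits]

open Classical in
lemma visits_succ (t : ℕ) (v : V) :
    r.visits (t + 1) s v = r.visits t s v + if r.act (t + 1) s = v then 1 else 0 := by
  unfold Run.visits
  rw [Finset.sum_Icc_succ_top (by omega)]

lemma visits_nonneg (t : ℕ) (v : V) : 0 ≤ r.visits t s v :=
  Finset.sum_nonneg fun _ _ => by split_ifs <;> norm_num

lemma monotone_visits (v : V) : Monotone fun t => r.visits t s v := by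
  refine monotone_nat_of_le_succ fun t => ?_
  rw [visits_succ]
  split_ifs <;> linarith

variable [Fintype V]

lemma sum_visits (t : ℕ) : ∑ v, r.visits t s v = t := by
  induction t with
  | zero => simp [visits_zero]
  | succ t ih =>
    classical
    simp_rw [visits_succ]
    rw [Finset.sum_add_distrib, Finset.sum_ite_eq, ih]
    simp

lemma visits_div_mem_stdSimplex {t : ℕ} (ht : 0 < t) :
    (fun v => r.visits t s v / t) ∈ stdSimplex ℝ V := by
  refine ⟨fun v => div_nonneg (visits_nonneg r s t v) (by positivity), ?_⟩
  rw [← Finset.sum_div, sum_visits, div_self (by positivity)]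

variable {r s}

/-- Forced exploration: if an arm has stayed below the level of forced exploration since round `k`,
then every round since `k` went to an arm with at most as many visits, which leaves room for only
linearly many rounds in this number of visits. -/
lemma sqrt_sub_le_visits
    (hforced : ∀ t, (∃ u, r.visits t s u < √t - Fintype.card V / 2) →
      r.visits t s (r.act (t + 1) s) < √t - Fintype.card V / 2 ∧
      ∀ u, r.visits t s u < √t - Fintype.card V / 2 →
        r.visits t s (r.act (t + 1) s) ≤ r.visits t s u) (t : ℕ) (u : V) :
    √t - Fintype.card V - 2 ≤ r.visits t s u := by
  classical
  by_contra! hlt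
  set c := r.visits t s u with hc
  set K : ℝ := (Fintype.card V : ℝ) with hK
  have hK0 : 0 ≤ K := by positivity
  have hc0 : 0 ≤ c := visits_nonneg r s t u
  have hex : ∃ k : ℕ, c < √k - K / 2 := ⟨t, by linarith⟩
  set k := Nat.find hex with hk
  have hkspec : c < √k - K / 2 := Nat.find_spec hex
  have hkt : k ≤ t := Nat.find_min' hex (by linarith)
  have hkub : (k : ℝ) ≤ (c + K / 2) ^ 2 + 1 := by
    rcases Nat.eq_zero_or_pos k with h0 | h0
    · rw [h0, Nat.cast_zero]
      positivity
    · have h1 := Nat.find_min hex (m := k - 1) (by omega)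
      have h2 : √((k - 1 : ℕ) : ℝ) ≤ c + K / 2 := by linarith [not_lt.1 h1]
      have h3 := (Real.sqrt_le_left (by positivity)).1 h2
      rw [Nat.cast_sub h0] at h3
      push_cast at h3
      linarith
  -- The visits truncated at `c + 1` increase in total by one in each round from `k` on.
  have hpot : ∀ j, k + j ≤ t →
      (j : ℝ) ≤ ∑ v, min (r.visits (k + j) s v) (c + 1) := by
    intro j
    induction j with
    | zero =>
      intro _
      simp only [Nat.cast_zero]
      exact Finset.sum_nonneg fun v _ => le_min (visits_nonneg r s _ v) (by linarith)
    | succ j ih =>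
      intro hj
      have hu : r.visits (k + j) s u ≤ c := monotone_visits r s u (by omega : k + j ≤ t)
      have hlev : √(k : ℝ) ≤ √((k + j : ℕ) : ℝ) := Real.sqrt_le_sqrt (by exact_mod_cast (by omega))
      have hu' : r.visits (k + j) s u < √((k + j : ℕ) : ℝ) - K / 2 := by linarith
      have hv := ((hforced (k + j) ⟨u, hu'⟩).2 u hu').trans hu
      have := ih (by omega)
      have hsucc : ∀ v, min (r.visits (k + (j + 1)) s v) (c + 1)
          = min (r.visits (k + j) s v) (c + 1) + if r.act (k + j + 1) s = v then 1 else 0 := by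
        intro v
        rw [← add_assoc, visits_succ]
        split_ifs with h
        · subst h
          rw [min_eq_left (by linarith), min_eq_left (by linarith)]
        · simp
      simp_rw [hsucc]
      rw [Finset.sum_add_distrib, Finset.sum_ite_eq]
      push_cast
      simp only [Finset.mem_univ, if_true]
      linarith
  have h1 := hpot (t - k) (by omega)
  have h2 : ∑ v, min (r.visits (k + (t - k)) s v) (c + 1) ≤ K * (c + 1) := by
    refine (Finset.sum_le_sum fun v _ => min_le_right _ _).trans ?_
    rw [Finset.sum_const, nsmul_eq_mul, Finset.card_univ]
  rw [Nat.cast_sub hkt] at h1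
  have h3 : c + K + 2 < √t := by linarith
  have h4 := (Real.lt_sqrt (by positivity)).1 h3
  nlinarith [mul_nonneg hc0 hK0]

variable {w : ℕ → Ω → V → ℝ}

/-- The number of visits exceeds the cumulative target by at most `√t + 1`: a tracking round goes
to an arm that is not ahead of its target, a forced one to an arm with fewer than `√t` visits. -/
lemma visits_sub_target_le (hsimplex : ∀ t, w t s ∈ stdSimplex ℝ V)
    (hforced : ∀ t, (∃ u, r.visits t s u < √t - Fintype.card V / 2) →
      r.visits t s (r.act (t + 1) s) < √t - Fintype.card V / 2)
    (htrack : ∀ t, (¬ ∃ u, r.visits t s u < √t - Fintype.card V / 2) →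
      ∀ u, r.visits t s (r.act (t + 1) s) - ∑ n ∈ Finset.Icc 1 t, w n s (r.act (t + 1) s) ≤
        r.visits t s u - ∑ n ∈ Finset.Icc 1 t, w n s u) (t : ℕ) (u : V) :
    r.visits t s u - ∑ n ∈ Finset.Icc 1 t, w n s u ≤ √t + 1 := by
  classical
  have hsum : ∀ t : ℕ, ∑ v, (r.visits t s v - ∑ n ∈ Finset.Icc 1 t, w n s v) = 0 := by
    intro t
    rw [Finset.sum_sub_distrib, sum_visits, Finset.sum_comm]
    simp [(hsimplex _).2]
  have hK0 : (0 : ℝ) ≤ Fintype.card V := by positivity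
  induction t with
  | zero => simp [visits_zero]
  | succ t ih =>
    have hw : 0 ≤ w (t + 1) s u := (hsimplex _).1 u
    have hsq : √(t : ℝ) ≤ √((t + 1 : ℕ) : ℝ) := Real.sqrt_le_sqrt (by push_cast; linarith)
    rw [visits_succ, Finset.sum_Icc_succ_top (by omega)]
    split_ifs with hu
    · by_cases hS : ∃ v, r.visits t s v < √t - Fintype.card V / 2
      · have h1 := hforced t hS
        rw [hu] at h1
        have h2 : 0 ≤ ∑ n ∈ Finset.Icc 1 t, w n s u :=
          Finset.sum_nonneg fun n _ => (hsimplex n).1 u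
        linarith
      · have h1 := htrack t hS
        rw [hu] at h1
        have h2 : r.visits t s u - ∑ n ∈ Finset.Icc 1 t, w n s u ≤ 0 := by
          by_contra! hpos
          have : 0 < ∑ v, (r.visits t s v - ∑ n ∈ Finset.Icc 1 t, w n s v) :=
            Finset.sum_pos (fun v _ => hpos.trans_le (h1 v)) ⟨u, Finset.mem_univ u⟩
          linarith [hsum t]
        have h3 := Real.sqrt_nonneg ((t + 1 : ℕ) : ℝ)
        linarith
    · linarith

/-- Since the deviations from the target sum to zero, a common upper bound also bounds them from
below. -/
lemma abs_visits_sub_target_le (hsimplex : ∀ t, w t s ∈ stdSimplex ℝ V)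
    (hforced : ∀ t, (∃ u, r.visits t s u < √t - Fintype.card V / 2) →
      r.visits t s (r.act (t + 1) s) < √t - Fintype.card V / 2)
    (htrack : ∀ t, (¬ ∃ u, r.visits t s u < √t - Fintype.card V / 2) →
      ∀ u, r.visits t s (r.act (t + 1) s) - ∑ n ∈ Finset.Icc 1 t, w n s (r.act (t + 1) s) ≤
        r.visits t s u - ∑ n ∈ Finset.Icc 1 t, w n s u) (t : ℕ) (u : V) :
    |r.visits t s u - ∑ n ∈ Finset.Icc 1 t, w n s u| ≤ Fintype.card V * (√t + 1) := by
  classical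
  have hub := visits_sub_target_le hsimplex hforced htrack t
  have hsum : ∑ v, (r.visits t s v - ∑ n ∈ Finset.Icc 1 t, w n s v) = 0 := by
    rw [Finset.sum_sub_distrib, sum_visits, Finset.sum_comm]
    simp [(hsimplex _).2]
  have hK1 : (1 : ℝ) ≤ Fintype.card V := by
    exact_mod_cast Fintype.card_pos_iff.2 ⟨u⟩
  have hs : 0 ≤ √(t : ℝ) + 1 := by positivity
  rw [abs_le]
  constructor
  · rw [← Finset.add_sum_erase _ _ (Finset.mem_univ u)] at hsum
    have h1 := Finset.sum_le_card_nsmul (Finset.univ.erase u) _ _ fun v _ => hub v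
    rw [Finset.card_erase_of_mem (Finset.mem_univ u), nsmul_eq_mul, Finset.card_univ,
      Nat.cast_sub (Fintype.card_pos_iff.2 ⟨u⟩)] at h1
    push_cast at h1
    nlinarith
  · exact (hub u).trans (le_mul_of_one_le_left hs hK1)

end Tracking

/-! ### The statistic grows linearly once the estimates are accurate -/

section Growth

variable {V Ω : Type*}

lemma Model.mean_eq (ν : Model V) (u : V) : ν.mean u = deriv (logPartition ν.ρ) (ν.θ u) :=
  integral_expFamily (ν.param_mem u)

lemma Model.mean_mem (ν : Model V) (u : V) : ν.mean u ∈ meanSpace ν.ρ :=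
  ⟨ν.θ u, ν.param_mem u, (ν.mean_eq u).symm⟩

lemma Model.exists_best (ν : Model V) : ∃ a, ∀ u, u ≠ a → ν.mean u < ν.mean a := ν.unique_best

variable [Nontrivial V]

lemma Model.strictMonoOn_deriv (ν : Model V) :
    StrictMonoOn (deriv (logPartition ν.ρ)) (paramSpace ν.ρ) := by
  obtain ⟨a, ha⟩ := ν.exists_best
  obtain ⟨u, hu⟩ := exists_ne a
  have := (ha u hu).ne
  rw [ν.mean_eq, ν.mean_eq] at this
  exact strictMonoOn_deriv_logPartition (ν.param_mem u) (ν.param_mem a) this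

variable [Fintype V]

lemma Model.infoRate_le (ν : Model V) {ω : V → ℝ} (hω : ω ∈ stdSimplex ℝ V) :
    infoRate ν.ρ ν.G ν.mean ω ≤ ν.charTime⁻¹ := by
  obtain ⟨a, ha⟩ := ν.exists_best
  rw [Model.charTime, FeedbackBAI.charTime, inv_inv]
  exact le_ciSup (bddAbove_infoRate ν.strictMonoOn_deriv ν.weight_mem ν.mean_mem ha) ⟨ω, hω⟩

lemma Model.charTime_pos (ν : Model V) : 0 < ν.charTime := by
  obtain ⟨a, ha⟩ := ν.exists_best
  obtain ⟨ω, hω, hpos⟩ := exists_infoMin_pos (fun v u => (ν.weight_mem v u).1) ν.observable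
    ν.mean_mem ha
  rw [← infoRate_eq_infoMin ha] at hpos
  exact inv_pos.1 (hpos.trans_le (ν.infoRate_le hω))

/-- At time `t` every vertex has been observed and the estimates of graph and means are accurate
up to `ξ`. -/
def Run.Accurate (r : Run V Ω) (ν : Model V) (σ : Setting) (ξ : ℝ) (t : ℕ) (s : Ω) : Prop :=
  (∀ u, 0 < r.obsCount σ t s u) ∧ (∀ v u, r.graphEst ν σ t s v u ∈ Set.Icc (0 : ℝ) 1) ∧
  (∀ v u, |r.graphEst ν σ t s v u - ν.G v u| ≤ ξ) ∧ ∀ u, |r.meanEst σ t s u - ν.mean u| ≤ ξ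

/-- If all estimates after time `n₀` are accurate, then the statistic grows at almost the optimal
rate, up to a loss that is linear in `n₀`. By concavity the average of the targets is nearly as good
as the targets are, and the proportions of the visits follow this average. -/
lemma Model.exists_glr_ge (ν : Model V) (σ : Setting) (r : Run V Ω) (w : ℕ → Ω → V → ℝ)
    {κ : ℝ} (hκ : κ < ν.charTime⁻¹) :
    ∃ ξ > 0, ∃ t₁ : ℕ, ∀ s, (∀ t, w t s ∈ stdSimplex ℝ V) →
      (∀ t, (∀ u, 0 < r.obsCount σ t s u) →
        w t s ∈ optAlloc ν.ρ (r.graphEst ν σ t s) (r.meanEst σ t s)) →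
      (∀ t (u : V), |r.visits t s u - ∑ n ∈ Finset.Icc 1 t, w n s u|
        ≤ Fintype.card V * (√t + 1)) →
      ∀ n₀ : ℕ, (∀ t, n₀ < t → r.Accurate ν σ ξ t s) →
      ∀ t, n₀ < t → t₁ ≤ t → κ * t - n₀ * ν.charTime⁻¹ ≤ r.glr ν σ t s := by
  obtain ⟨a, ha⟩ := ν.exists_best
  set F := ν.charTime⁻¹ with hF
  have hF0 : 0 < F := inv_pos.2 ν.charTime_pos
  -- One `ε` is lost at time `t` and two in the comparison of the plug-in optimum with the true one.
  set ε := (F - κ) / 3 with hε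
  have hε0 : 0 < ε := by rw [hε]; linarith
  obtain ⟨ξ, hξ, happrox⟩ :=
    infoRate_uniform_approx ν.strictMonoOn_deriv ν.weight_mem ν.mean_mem ha hε0
  have hlim : Tendsto (fun t : ℕ => (Fintype.card V : ℝ) * (√t + 1) / t) atTop (𝓝 0) := by
    have h1 : Tendsto (fun t : ℕ => (√(t : ℝ))⁻¹) atTop (𝓝 0) :=
      (Real.tendsto_sqrt_atTop.comp tendsto_natCast_atTop_atTop).inv_tendsto_atTop
    have h2 : Tendsto (fun t : ℕ => ((t : ℝ))⁻¹) atTop (𝓝 0) :=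
      tendsto_natCast_atTop_atTop.inv_tendsto_atTop
    have h3 := (h1.add h2).const_mul (Fintype.card V : ℝ)
    rw [add_zero, mul_zero] at h3
    refine h3.congr fun t => ?_
    rw [mul_div_assoc, add_div, Real.sqrt_div_self', one_div, one_div]
  obtain ⟨t₁, ht₁⟩ := eventually_atTop.1 (hlim.eventually_le_const hξ)
  refine ⟨ξ, hξ, t₁, ?_⟩
  intro s hsimplex hopt hdev n₀ hacc t hn₀t ht
  have ht0 : 0 < t := by omega
  have htr : (0 : ℝ) < t := by exact_mod_cast ht0
  set R := infoRate ν.ρ ν.G ν.mean with hR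
  have hR0 : ∀ ω ∈ stdSimplex ℝ V, 0 ≤ R ω := fun ω hω => by
    rw [hR, infoRate_eq_infoMin ha]
    exact infoMin_nonneg (fun v u => (ν.weight_mem v u).1) ν.mean_mem hω.1
  have hnear : ∀ n, n₀ < n → F - 2 * ε ≤ R (w n s) := by
    intro n hn
    obtain ⟨hobs, hG01, hG, hμ⟩ := hacc n hn
    have hmax := (hopt n hobs).2
    have : F ≤ R (w n s) + 2 * ε := by
      rw [hF, Model.charTime, FeedbackBAI.charTime, inv_inv]
      have : Nonempty (stdSimplex ℝ V) := ⟨⟨w n s, hsimplex n⟩⟩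
      refine ciSup_le fun ω => ?_
      have h1 := (abs_le.1 (happrox _ _ ω ω hG01 hG hμ ω.2 ω.2
        (fun u => by simpa using hξ.le))).1
      have h2 := (abs_le.1 (happrox _ _ (w n s) (w n s) hG01 hG hμ (hsimplex n) (hsimplex n)
        (fun u => by simpa using hξ.le))).2
      have h3 := hmax ω ω.2
      linarith
    linarith
  set W : V → ℝ := ∑ n ∈ Finset.Icc 1 t, (t : ℝ)⁻¹ • w n s with hW
  have hcard : ∑ n ∈ Finset.Icc 1 t, (t : ℝ)⁻¹ = 1 := by
    simp [htr.ne']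
  have hWmem : W ∈ stdSimplex ℝ V :=
    (convex_stdSimplex ℝ V).sum_mem (fun _ _ => by positivity) hcard fun n _ => hsimplex n
  have hjensen : ∑ n ∈ Finset.Icc 1 t, (t : ℝ)⁻¹ • R (w n s) ≤ R W := by
    have hRF : R = infoMin ν.ρ a ν.G ν.mean := by
      ext ω
      exact infoRate_eq_infoMin ha _ _
    rw [hRF]
    exact (concaveOn_infoMin (fun v u => (ν.weight_mem v u).1) ν.mean_mem).le_map_sum
      (fun _ _ => by positivity) hcard fun n _ => hsimplex n
  -- The first `n₀` targets may be useless, but their rates are nonnegative.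
  have hsum : t * (F - 2 * ε) - n₀ * F ≤ ∑ n ∈ Finset.Icc 1 t, R (w n s) := by
    have h1 : ∑ n ∈ Finset.Icc 1 t, (F - 2 * ε - if n ≤ n₀ then F else 0)
        ≤ ∑ n ∈ Finset.Icc 1 t, R (w n s) := by
      refine Finset.sum_le_sum fun n _ => ?_
      split_ifs with h
      · linarith [hR0 _ (hsimplex n)]
      · linarith [hnear n (by omega)]
    refine le_trans ?_ h1
    rw [Finset.sum_sub_distrib, ← Finset.sum_filter]
    simp only [Finset.sum_const, Nat.card_Icc, nsmul_eq_mul]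
    have h2 : ((Finset.Icc 1 t).filter (· ≤ n₀)).card ≤ n₀ := by
      calc _ ≤ (Finset.Icc 1 n₀).card := Finset.card_le_card fun n hn => by
            simp only [Finset.mem_filter, Finset.mem_Icc] at hn ⊢
            omega
        _ = n₀ := by simp
    have h3 : (((Finset.Icc 1 t).filter (· ≤ n₀)).card : ℝ) * F ≤ n₀ * F :=
      mul_le_mul_of_nonneg_right (by exact_mod_cast h2) hF0.le
    simp only [Nat.add_sub_cancel]
    linarith
  have htW : t * (F - 2 * ε) - n₀ * F ≤ t * R W := by
    refine hsum.trans ?_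
    have h1 := mul_le_mul_of_nonneg_left hjensen htr.le
    rwa [Finset.mul_sum, Finset.sum_congr rfl fun n _ => by
      rw [smul_eq_mul, ← mul_assoc, mul_inv_cancel₀ htr.ne', one_mul]] at h1
  obtain ⟨hobs, hG01, hG, hμ⟩ := hacc t hn₀t
  have hclose : ∀ u, |r.visits t s u / t - W u| ≤ ξ := by
    intro u
    have hWu : W u = (∑ n ∈ Finset.Icc 1 t, w n s u) / t := by
      rw [hW, Finset.sum_apply, Finset.sum_div]
      exact Finset.sum_congr rfl fun n _ => by
        rw [Pi.smul_apply, smul_eq_mul, div_eq_inv_mul]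
    rw [hWu, ← sub_div, abs_div, abs_of_pos htr]
    exact (div_le_div_of_nonneg_right (hdev t u) htr.le).trans (ht₁ t ht)
  have h1 := (abs_le.1 (happrox _ _ _ W hG01 hG hμ (visits_div_mem_stdSimplex r s ht0) hWmem
    hclose)).1
  rw [Run.glr, if_pos hobs]
  have h2 := mul_le_mul_of_nonneg_left h1 htr.le
  have h3 : κ = F - 3 * ε := by rw [hε]; ring
  rw [h3]
  linarith

end Growth

/-! ### Asymptotics of the threshold -/

section Threshold

lemma exists_hFun_eq {y : ℝ} (hy : 1 ≤ y) : ∃ u ∈ Set.Ici (1 : ℝ), hFun u = y := by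
  have hcont : ContinuousOn hFun (Set.Icc 1 (4 * y)) := by
    unfold hFun
    exact continuousOn_id.sub (Real.continuousOn_log.mono fun u hu => by
      simp only [Set.mem_compl_iff, Set.mem_singleton_iff]
      linarith [hu.1])
  have h1 : hFun 1 ≤ y := by simpa [hFun] using hy
  have h2 : y ≤ hFun (4 * y) := by
    have h3 : Real.log (4 * y) ≤ (4 - 1) + (y - 1) := by
      rw [Real.log_mul (by norm_num) (by linarith)]
      exact add_le_add (Real.log_le_sub_one_of_pos (by norm_num))
        (Real.log_le_sub_one_of_pos (by linarith))
    unfold hFun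
    linarith
  obtain ⟨u, hu, h⟩ := intermediate_value_Icc (by linarith) hcont ⟨h1, h2⟩
  exact ⟨u, hu.1, h⟩

lemma hFun_hInv {y : ℝ} (hy : 1 ≤ y) : hFun (hInv y) = y :=
  Function.invFunOn_eq (exists_hFun_eq hy)

lemma one_le_hInv {y : ℝ} (hy : 1 ≤ y) : 1 ≤ hInv y :=
  Function.invFunOn_mem (exists_hFun_eq hy)

lemma tendsto_hInv_atTop : Tendsto hInv atTop atTop := by
  refine tendsto_atTop_mono' _ ?_ tendsto_id
  filter_upwards [eventually_ge_atTop 1] with y hy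
  have h1 := hFun_hInv hy
  have h2 := Real.log_nonneg (one_le_hInv hy)
  unfold hFun at h1
  simp only [id]
  linarith

lemma tendsto_hInv_div : Tendsto (fun y => hInv y / y) atTop (𝓝 1) := by
  have h1 : Tendsto (fun u : ℝ => 1 - Real.log u / u) atTop (𝓝 1) := by
    have := Real.isLittleO_log_id_atTop.tendsto_div_nhds_zero
    simpa using this.const_sub 1
  have h2 := ((h1.comp tendsto_hInv_atTop).inv₀ one_ne_zero)
  rw [inv_one] at h2
  refine h2.congr' ?_
  filter_upwards [eventually_ge_atTop 1] with y hy
  have h3 := hFun_hInv hy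
  have h4 := one_le_hInv hy
  unfold hFun at h3
  simp only [Function.comp]
  rw [← inv_div y (hInv y)]
  congr 1
  have h5 : hInv y ≠ 0 := by linarith
  rw [eq_div_iff h5, sub_mul, one_mul, div_mul_cancel₀ _ h5, h3]

lemma tendsto_hTilde_div (z : ℝ) : Tendsto (fun y => hTilde z y / y) atTop (𝓝 1) := by
  have h1 : Tendsto (fun y => Real.exp (1 / hInv y)) atTop (𝓝 1) := by
    have : Tendsto (fun y => 1 / hInv y) atTop (𝓝 0) := by
      simp only [one_div]
      exact tendsto_hInv_atTop.inv_tendsto_atTop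
    have h := (Real.continuous_exp.tendsto 0).comp this
    rwa [Real.exp_zero] at h
  have h2 := tendsto_hInv_div.mul h1
  rw [one_mul] at h2
  refine h2.congr' ?_
  filter_upwards [eventually_ge_atTop (hFun (1 / Real.log z))] with y hy
  rw [hTilde, if_pos hy]
  ring

lemma tendsto_cExp_div : Tendsto (fun x => cExp x / x) atTop (𝓝 1) := by
  set c := Real.log (2 * (riemannZeta 2).re)
  have hinv : Tendsto (fun x : ℝ => x⁻¹) atTop (𝓝 0) := tendsto_inv_atTop_zero
  have h1x : Tendsto (fun x : ℝ => 1 + x) atTop atTop := tendsto_atTop_add_const_left _ 1 tendsto_id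
  set g : ℝ → ℝ := fun x => (hInv (1 + x) + c) / 2 with hg
  have hgtop : Tendsto g atTop atTop :=
    (tendsto_atTop_add_const_right _ c (tendsto_hInv_atTop.comp h1x)).atTop_div_const two_pos
  have hgx : Tendsto (fun x => g x / x) atTop (𝓝 (1 / 2)) := by
    have h2 := (((tendsto_hInv_div.comp h1x).mul (hinv.add_const 1)).add
      (hinv.const_mul c)).div_const 2
    simp only [zero_add, mul_one, mul_zero, add_zero] at h2
    refine h2.congr' ?_
    filter_upwards [eventually_gt_atTop 0] with x hx
    simp only [Function.comp, hg]
    have : 1 + x ≠ 0 := by linarith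
    field_simp
  have h3 := ((((tendsto_hTilde_div (3 / 2)).comp hgtop).mul hgx).const_mul 2)
  rw [show (2 : ℝ) * (1 * (1 / 2)) = 1 by norm_num] at h3
  refine h3.congr' ?_
  filter_upwards [hgtop.eventually_gt_atTop 0] with x hx
  simp only [Function.comp, cExp]
  change _ = 2 * hTilde (3 / 2) (g x) / x
  field_simp

/-- The part of the threshold that depends on `δ`. -/
noncomputable def thresholdConst (K : ℕ) (δ : ℝ) : ℝ :=
  2 * cExp (Real.log (((K : ℝ) - 1) / δ) / 2)

lemma tendsto_log_one_div : Tendsto (fun δ : ℝ => Real.log (1 / δ)) (𝓝[>] 0) atTop := by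
  simp only [one_div]
  exact Real.tendsto_log_atTop.comp tendsto_inv_nhdsGT_zero

lemma tendsto_thresholdConst_div {K : ℕ} (hK : 2 ≤ K) :
    Tendsto (fun δ => thresholdConst K δ / Real.log (1 / δ)) (𝓝[>] 0) (𝓝 1) := by
  have hK' : (0 : ℝ) < K - 1 := by
    have : (2 : ℝ) ≤ K := by exact_mod_cast hK
    linarith
  set c := Real.log ((K : ℝ) - 1)
  set g : ℝ → ℝ := fun ℓ => (c + ℓ) / 2 with hg
  have hgtop : Tendsto g atTop atTop :=
    (tendsto_atTop_add_const_left _ c tendsto_id).atTop_div_const two_pos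
  have h1 : Tendsto (fun ℓ => g ℓ / ℓ) atTop (𝓝 (1 / 2)) := by
    have h2 := ((tendsto_inv_atTop_zero (𝕜 := ℝ)).const_mul c |>.add_const 1).div_const 2
    rw [mul_zero, zero_add] at h2
    refine h2.congr' ?_
    filter_upwards [eventually_gt_atTop 0] with x hx
    simp only [hg]
    field_simp
  have h3 := (((tendsto_cExp_div.comp hgtop).mul h1).const_mul 2).comp tendsto_log_one_div
  rw [show (2 : ℝ) * (1 * (1 / 2)) = 1 by norm_num] at h3
  refine h3.congr' ?_
  filter_upwards [(hgtop.comp tendsto_log_one_div).eventually_gt_atTop 0,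
    self_mem_nhdsWithin] with δ hδ hδ0
  simp only [Function.comp] at hδ ⊢
  have hlog : Real.log (((K : ℝ) - 1) / δ) = c + Real.log (1 / δ) := by
    rw [div_eq_mul_one_div, Real.log_mul hK'.ne' (one_div_pos.2 hδ0).ne']
  unfold thresholdConst
  rw [hlog]
  change _ = 2 * cExp (g (Real.log (1 / δ))) / _
  field_simp

/-- The part of the threshold that depends on time is sublinear. -/
lemma exists_log_log_le {η : ℝ} (hη : 0 < η) :
    ∃ C : ℝ, 0 ≤ C ∧ ∀ t : ℕ, 6 * Real.log (1 + Real.log t) ≤ η * t + C := by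
  have hlogx : ∀ {x : ℝ}, 0 < x → Real.log x ≤ (η / 6) * x + Real.log (6 / η) := by
    intro x hx
    have h1 := Real.log_le_sub_one_of_pos (show 0 < (η / 6) * x by positivity)
    have h2 : Real.log x = Real.log ((η / 6) * x) + Real.log (6 / η) := by
      rw [← Real.log_mul (by positivity) (by positivity)]
      congr 1
      field_simp
    linarith
  refine ⟨6 * |Real.log (6 / η)|, by positivity, fun t => ?_⟩
  rcases Nat.eq_zero_or_pos t with h0 | h0
  · simp [h0]
  · have ht : (1 : ℝ) ≤ t := by exact_mod_cast h0
    have h1 := Real.log_nonneg ht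
    have h2 : Real.log (1 + Real.log t) ≤ Real.log t := by
      have := Real.log_le_sub_one_of_pos (show 0 < 1 + Real.log t by linarith)
      linarith
    have h3 := hlogx (show (0 : ℝ) < t by linarith)
    have h4 := le_abs_self (Real.log (6 / η))
    linarith

end Threshold

/-! ### The stopping time after the last inaccurate estimate -/

section StopTime

variable {V Ω : Type*} [Fintype V] [Nontrivial V]

lemma stopTime_le (r : Run V Ω) (ν : Model V) (σ : Setting) {δ : ℝ} {s : Ω} {t : ℕ} (ht : 1 ≤ t)
    (h : threshold (Fintype.card V) t δ ≤ r.glr ν σ t s) : r.stopTime ν σ δ s ≤ t :=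
  iInf₂_le (f := fun (t : ℕ) (_ : t ∈ {t : ℕ | 1 ≤ t ∧
    threshold (Fintype.card V) t δ ≤ r.glr ν σ t s}) => (t : ℕ∞)) t ⟨ht, h⟩

/-- The event on which the sampling rule behaves as prescribed. -/
def Run.Tracks (r : Run V Ω) (ν : Model V) (σ : Setting) (w : ℕ → Ω → V → ℝ) (s : Ω) : Prop :=
  (∀ t, w t s ∈ stdSimplex ℝ V) ∧
  (∀ t, (∀ u, 0 < r.obsCount σ t s u) →
    w t s ∈ optAlloc ν.ρ (r.graphEst ν σ t s) (r.meanEst σ t s)) ∧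
  (∀ t, (∃ u, r.visits t s u < √t - Fintype.card V / 2) →
    r.visits t s (r.act (t + 1) s) < √t - Fintype.card V / 2 ∧
    ∀ u, r.visits t s u < √t - Fintype.card V / 2 →
      r.visits t s (r.act (t + 1) s) ≤ r.visits t s u) ∧
  (∀ t, (¬ ∃ u, r.visits t s u < √t - Fintype.card V / 2) →
    ∀ u, r.visits t s (r.act (t + 1) s) - ∑ n ∈ Finset.Icc 1 t, w n s (r.act (t + 1) s) ≤
      r.visits t s u - ∑ n ∈ Finset.Icc 1 t, w n s u)

/-- The stopping time is at most `thresholdConst / κ` plus a term that is linear in the last time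
`n₀` of an inaccurate estimate. -/
lemma Model.exists_stopTime_le (ν : Model V) (σ : Setting) (r : Run V Ω) (w : ℕ → Ω → V → ℝ)
    {κ : ℝ} (hκ0 : 0 < κ) (hκ : κ < ν.charTime⁻¹) :
    ∃ ξ > 0, ∃ C : ℝ, 0 ≤ C ∧ ∀ s, r.Tracks ν σ w s → ∀ n₀ : ℕ,
      (∀ t, n₀ < t → r.Accurate ν σ ξ t s) → ∀ δ : ℝ,
      (r.stopTime ν σ δ s : ℝ≥0∞) ≤
        ENNReal.ofReal (thresholdConst (Fintype.card V) δ / κ) + ENNReal.ofReal C * (n₀ + 1) := by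
  set F := ν.charTime⁻¹ with hF
  have hF0 : 0 < F := inv_pos.2 ν.charTime_pos
  obtain ⟨κ', hκκ', hκ'F⟩ := exists_between hκ
  obtain ⟨ξ, hξ, t₁, hglr⟩ := ν.exists_glr_ge σ r w hκ'F
  obtain ⟨B, hB0, hB⟩ := exists_log_log_le (sub_pos.2 hκκ')
  refine ⟨ξ, hξ, t₁ + B / κ + F / κ + 3, by positivity, ?_⟩
  intro s htracks n₀ hacc δ
  obtain ⟨h1, h2, h3, h4⟩ := htracks
  have hdev := abs_visits_sub_target_le (w := w) h1 (fun t ht => (h3 t ht).1) h4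
  set A := thresholdConst (Fintype.card V) δ with hA
  have hn0 : (0 : ℝ) ≤ n₀ := by positivity
  -- At this time the lower bound on the statistic exceeds the upper bound on the threshold.
  set T : ℕ := n₀ + 1 + t₁ + (⌈A / κ⌉₊ + ⌈(B + n₀ * F) / κ⌉₊) with hT
  have hTr : (A + (B + n₀ * F)) / κ ≤ T := by
    rw [add_div, hT]
    push_cast
    have := Nat.le_ceil (A / κ)
    have := Nat.le_ceil ((B + n₀ * F) / κ)
    have : (0 : ℝ) ≤ t₁ := by positivity
    linarith
  rw [div_le_iff₀ hκ0] at hTr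
  have hstopTime : r.stopTime ν σ δ s ≤ T := by
    refine stopTime_le r ν σ (by omega) ?_
    have h5 := hglr s h1 h2 hdev n₀ hacc T (by omega) (by omega)
    refine le_trans ?_ h5
    have h6 := hB T
    have h7 : threshold (Fintype.card V) T δ = A + 6 * Real.log (1 + Real.log T) := rfl
    rw [h7]
    linarith
  have h8 : (r.stopTime ν σ δ s : ℝ≥0∞) ≤ T := by
    have := ENat.toENNReal_le.2 hstopTime
    simpa using this
  have hceil : (⌈A / κ⌉₊ : ℝ) ≤ max (A / κ) 0 + 1 := by
    rcases le_total 0 (A / κ) with h | h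
    · have := (Nat.ceil_lt_add_one h).le
      linarith [le_max_left (A / κ) 0]
    · rw [Nat.ceil_eq_zero.2 h, Nat.cast_zero]
      linarith [le_max_right (A / κ) 0]
  have hceil2 : (⌈(B + n₀ * F) / κ⌉₊ : ℝ) ≤ (B + n₀ * F) / κ + 1 :=
    (Nat.ceil_lt_add_one (by positivity)).le
  have h9 : (T : ℝ) ≤ max (A / κ) 0 + (t₁ + B / κ + F / κ + 3) * (n₀ + 1) := by
    rw [hT]
    push_cast
    have e : (B + n₀ * F) / κ = B / κ + n₀ * (F / κ) := by ring
    replace hceil2 := hceil2.trans_eq (by rw [e])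
    have p1 : 0 ≤ B / κ := by positivity
    have p2 : 0 ≤ F / κ := by positivity
    have p3 : (0 : ℝ) ≤ t₁ := by positivity
    nlinarith [mul_nonneg p1 hn0, mul_nonneg p3 hn0]
  refine h8.trans ?_
  rw [← ENNReal.ofReal_natCast T]
  refine (ENNReal.ofReal_le_ofReal h9).trans ?_
  rw [ENNReal.ofReal_add (le_max_right _ _) (by positivity), ENNReal.ofReal_mul (by positivity),
    ENNReal.ofReal_max, ENNReal.ofReal_zero, max_eq_left zero_le,
    ENNReal.ofReal_add hn0 zero_le_one, ENNReal.ofReal_natCast, ENNReal.ofReal_one]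

end StopTime

/-! ### Exponential tail bounds under adaptive sampling -/

section Adaptive

lemma measurable_apply_of_countable {V Ω β : Type*} [Countable V] [MeasurableSpace V]
    [MeasurableSingletonClass V] [MeasurableSpace β] {m : MeasurableSpace Ω} {A : Ω → V}
    (hA : Measurable A) {g : V → Ω → β} (hg : ∀ v, Measurable (g v)) :
    Measurable fun s => g (A s) s :=
  (measurable_from_prod_countable_right (f := fun p : V × Ω => g p.1 p.2) hg).comp
    (hA.prodMk measurable_id)

variable {V Ω : Type*}

/-- The independent family of all edge activations and rewards. -/
def Run.noise (r : Run V Ω) (i : ℕ × (V × V ⊕ V)) : Ω → ℝ :=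
  Sum.elim (fun e : V × V => r.edge i.1 e.1 e.2) (fun u : V => r.rew i.1 u) i.2

/-- The information in all edge activations and rewards of the rounds in `S`. -/
abbrev Run.noiseSigma (r : Run V Ω) (S : Set ℕ) : MeasurableSpace Ω :=
  ⨆ i ∈ {i : ℕ × (V × V ⊕ V) | i.1 ∈ S}, MeasurableSpace.comap (r.noise i) inferInstance

lemma noiseSigma_mono (r : Run V Ω) {S T : Set ℕ} (h : S ⊆ T) : r.noiseSigma S ≤ r.noiseSigma T :=
  biSup_mono fun _ hi => h hi

lemma measurable_noise_noiseSigma (r : Run V Ω) {S : Set ℕ} (i : ℕ × (V × V ⊕ V)) (h : i.1 ∈ S) :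
    Measurable[r.noiseSigma S] (r.noise i) :=
  measurable_iff_comap_le.2 <|
    le_iSup₂_of_le (f := fun (i : ℕ × (V × V ⊕ V)) (_ : i ∈ {i : ℕ × (V × V ⊕ V) | i.1 ∈ S}) =>
      MeasurableSpace.comap (r.noise i) inferInstance) i h le_rfl

lemma measurable_edge_noiseSigma (r : Run V Ω) {S : Set ℕ} {n : ℕ} (h : n ∈ S) (v u : V) :
    Measurable[r.noiseSigma S] (r.edge n v u) :=
  measurable_noise_noiseSigma r (n, Sum.inl (v, u)) h

lemma measurable_rew_noiseSigma (r : Run V Ω) {S : Set ℕ} {n : ℕ} (h : n ∈ S) (u : V) :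
    Measurable[r.noiseSigma S] (r.rew n u) :=
  measurable_noise_noiseSigma r (n, Sum.inr u) h

variable [MeasurableSpace V] {mΩ : MeasurableSpace Ω} {r : Run V Ω}
  {ν : Model V} {σ : Setting} {P : Measure Ω}

lemma Run.IsInteraction.measurable_noise (hr : r.IsInteraction ν σ P) (i : ℕ × (V × V ⊕ V)) :
    Measurable (r.noise i) := by
  obtain ⟨n, ⟨v, u⟩ | u⟩ := i
  · exact hr.measurable_edge n v u
  · exact hr.measurable_rew n u

lemma Run.IsInteraction.noiseSigma_le (hr : r.IsInteraction ν σ P) (S : Set ℕ) :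
    r.noiseSigma S ≤ mΩ :=
  iSup₂_le fun i _ => (hr.measurable_noise i).comap_le

lemma Run.IsInteraction.indep_noiseSigma (hr : r.IsInteraction ν σ P) {S T : Set ℕ}
    (h : Disjoint S T) : Indep (r.noiseSigma S) (r.noiseSigma T) P := by
  refine indep_iSup_of_disjoint (fun i => (hr.measurable_noise i).comap_le)
    ((iIndepFun_iff_iIndep _ _ _).1 hr.indep) ?_
  rw [Set.disjoint_left] at h ⊢
  exact fun i hi hi' => h hi hi'

variable [Countable V] [MeasurableSingletonClass V]

lemma Run.IsInteraction.history_le (hr : r.IsInteraction ν σ P) (t : ℕ) :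
    r.history σ t ≤ r.noiseSigma (Set.Iic t) := by
  induction t with
  | zero => simp [Run.history]
  | succ t ih =>
    have hmono : r.noiseSigma (Set.Iic t) ≤ r.noiseSigma (Set.Iic (t + 1)) :=
      noiseSigma_mono r (Set.Iic_subset_Iic.2 (Nat.le_succ t))
    have hact : Measurable[r.noiseSigma (Set.Iic (t + 1))] (r.act (t + 1)) :=
      (hr.adapted t).mono (ih.trans hmono) le_rfl
    have hedge : ∀ u, Measurable[r.noiseSigma (Set.Iic (t + 1))]
        (fun s => r.edge (t + 1) (r.act (t + 1) s) u s) := fun u =>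
      measurable_apply_of_countable (m := r.noiseSigma (Set.Iic (t + 1))) hact
        (g := fun v s => r.edge (t + 1) v u s) fun v =>
          measurable_edge_noiseSigma r (Set.mem_Iic.2 le_rfl) v u
    have hround : r.roundInfo σ (t + 1) ≤ r.noiseSigma (Set.Iic (t + 1)) := by
      refine sup_le (sup_le hact.comap_le (iSup_le fun u => ?_)) ?_
      · refine Measurable.comap_le ?_
        exact Measurable.mul (hedge u) (measurable_rew_noiseSigma r (Set.mem_Iic.2 le_rfl) u)
      · cases σ with
        | uninformed => exact bot_le
        | informed => exact iSup_le fun u => (hedge u).comap_le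
        | informedKnownGraph => exact iSup_le fun u => (hedge u).comap_le
    refine iSup₂_le fun n hn => ?_
    rw [Finset.mem_Icc] at hn
    rcases Nat.lt_or_ge t n with h | h
    · obtain rfl : n = t + 1 := by omega
      exact hround
    · refine le_trans ?_ (ih.trans hmono)
      exact le_iSup₂_of_le (f := fun (n : ℕ) (_ : n ∈ Finset.Icc 1 t) => r.roundInfo σ n) n
        (Finset.mem_Icc.2 ⟨hn.1, h⟩) le_rfl

lemma Run.IsInteraction.measurable_act_succ (hr : r.IsInteraction ν σ P) (t : ℕ) :
    Measurable[r.noiseSigma (Set.Iic t)] (r.act (t + 1)) :=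
  (hr.adapted t).mono (hr.history_le t) le_rfl

end Adaptive

section Supermartingale

variable {V Ω : Type*} [Fintype V] [MeasurableSpace V] [MeasurableSingletonClass V]
  {mΩ : MeasurableSpace Ω} {r : Run V Ω} {ν : Model V} {σ : Setting} {P : Measure Ω}

/-- A product of nonnegative factors, each a function of the chosen vertex and the fresh noise of
its round, has expectation at most `1` if every vertex's factor has. -/
lemma Run.IsInteraction.lintegral_prod_le_one (hr : r.IsInteraction ν σ P)
    [IsProbabilityMeasure P] {φ : ℕ → V → Ω → ℝ≥0∞}
    (hφ : ∀ n v, Measurable[r.noiseSigma {n}] (φ n v)) (hle : ∀ n v, ∫⁻ s, φ n v s ∂P ≤ 1) (t : ℕ) :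
    ∫⁻ s, ∏ n ∈ Finset.Icc 1 t, φ n (r.act n s) s ∂P ≤ 1 := by
  classical
  have hmeas : ∀ t, Measurable[r.noiseSigma (Set.Iic t)]
      (fun s => ∏ n ∈ Finset.Icc 1 t, φ n (r.act n s) s) := by
    intro t
    refine Finset.measurable_fun_prod _ fun n hn => ?_
    rw [Finset.mem_Icc] at hn
    refine measurable_apply_of_countable (m := r.noiseSigma (Set.Iic t)) ?_ fun v => ?_
    · obtain ⟨k, rfl⟩ : ∃ k, n = k + 1 := ⟨n - 1, by omega⟩
      exact (hr.measurable_act_succ k).mono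
        (noiseSigma_mono r (Set.Iic_subset_Iic.2 (by omega))) le_rfl
    · exact (hφ n v).mono (noiseSigma_mono r (Set.singleton_subset_iff.2 hn.2)) le_rfl
  induction t with
  | zero => simp
  | succ t ih =>
    set Z : Ω → ℝ≥0∞ := fun s => ∏ n ∈ Finset.Icc 1 t, φ n (r.act n s) s with hZ
    set ψ : V → Ω → ℝ≥0∞ := fun v s => Z s * (r.act (t + 1) ⁻¹' {v}).indicator 1 s with hψ
    have hψm : ∀ v, Measurable[r.noiseSigma (Set.Iic t)] (ψ v) := by
      intro v
      refine (hmeas t).mul ?_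
      exact (measurable_const (a := (1 : ℝ≥0∞))).indicator
        (hr.measurable_act_succ t (measurableSet_singleton v))
    have hle' := hr.noiseSigma_le (Set.Iic t)
    have hle'' := hr.noiseSigma_le {t + 1}
    have hind : Indep (r.noiseSigma (Set.Iic t)) (r.noiseSigma {t + 1}) P :=
      hr.indep_noiseSigma (by
        rw [Set.disjoint_left]
        intro n hn hn'
        rw [Set.mem_singleton_iff] at hn'
        rw [Set.mem_Iic] at hn
        omega)
    have hsplit : ∀ s, ∏ n ∈ Finset.Icc 1 (t + 1), φ n (r.act n s) s
        = ∑ v, ψ v s * φ (t + 1) v s := by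
      intro s
      rw [Finset.prod_Icc_succ_top (by omega), Finset.sum_eq_single (r.act (t + 1) s)]
      · simp [hψ, hZ]
      · intro v _ hv
        simp [hψ, Set.indicator, hv.symm]
      · simp
    have hsum : ∀ s, ∑ v, ψ v s = Z s := by
      intro s
      rw [Finset.sum_eq_single (r.act (t + 1) s)]
      · simp [hψ]
      · intro v _ hv
        simp [hψ, Set.indicator, hv.symm]
      · simp
    calc ∫⁻ s, ∏ n ∈ Finset.Icc 1 (t + 1), φ n (r.act n s) s ∂P
        = ∑ v, ∫⁻ s, ψ v s * φ (t + 1) v s ∂P := by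
          simp_rw [hsplit]
          exact lintegral_finsetSum _ fun v _ =>
            ((hψm v).mono hle' le_rfl).mul ((hφ (t + 1) v).mono hle'' le_rfl)
      _ = ∑ v, (∫⁻ s, ψ v s ∂P) * ∫⁻ s, φ (t + 1) v s ∂P := by
          refine Finset.sum_congr rfl fun v _ => ?_
          exact lintegral_mul_eq_lintegral_mul_lintegral_of_independent_measurableSpace
            hle' hle'' hind (hψm v) (hφ (t + 1) v)
      _ ≤ ∑ v, ∫⁻ s, ψ v s ∂P :=
          Finset.sum_le_sum fun v _ => mul_le_of_le_one_right' (hle (t + 1) v)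
      _ = ∫⁻ s, Z s ∂P := by
          rw [← lintegral_finsetSum _ fun v _ => (hψm v).mono hle' le_rfl]
          simp_rw [hsum]
      _ ≤ 1 := ih

lemma Run.IsInteraction.measurable_sum (hr : r.IsInteraction ν σ P) {ζ : ℕ → V → Ω → ℝ}
    (hζ : ∀ n v, Measurable[r.noiseSigma {n}] (ζ n v)) (t : ℕ) :
    Measurable fun s => ∑ n ∈ Finset.Icc 1 t, ζ n (r.act n s) s := by
  refine Finset.measurable_fun_sum _ fun n hn => ?_
  rw [Finset.mem_Icc] at hn
  refine measurable_apply_of_countable ?_ fun v => (hζ n v).mono (hr.noiseSigma_le _) le_rfl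
  obtain ⟨k, rfl⟩ : ∃ k, n = k + 1 := ⟨n - 1, by omega⟩
  exact (hr.measurable_act_succ k).mono (hr.noiseSigma_le _) le_rfl

/-- Markov's inequality for the exponential supermartingale. The threshold `x` is fixed, but the sum
may grow with the random number of samples, so no union bound over this number is needed. -/
lemma Run.IsInteraction.measure_ge_le_exp (hr : r.IsInteraction ν σ P)
    [IsProbabilityMeasure P] {ζ : ℕ → V → Ω → ℝ}
    (hζ : ∀ n v, Measurable[r.noiseSigma {n}] (ζ n v))
    (hle : ∀ n v, ∫⁻ s, ENNReal.ofReal (Real.exp (ζ n v s)) ∂P ≤ 1) (t : ℕ) (x : ℝ) :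
    P {s | x ≤ ∑ n ∈ Finset.Icc 1 t, ζ n (r.act n s) s} ≤ ENNReal.ofReal (Real.exp (-x)) := by
  have h1 := hr.lintegral_prod_le_one (φ := fun n v s => ENNReal.ofReal (Real.exp (ζ n v s)))
    (fun n v => (Real.measurable_exp.comp (hζ n v)).ennreal_ofReal) hle t
  have h2 : ∀ s, ∏ n ∈ Finset.Icc 1 t, ENNReal.ofReal (Real.exp (ζ n (r.act n s) s))
      = ENNReal.ofReal (Real.exp (∑ n ∈ Finset.Icc 1 t, ζ n (r.act n s) s)) := by
    intro s
    rw [Real.exp_sum, ENNReal.ofReal_prod_of_nonneg fun _ _ => (Real.exp_pos _).le]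
  simp_rw [h2] at h1
  have hm : Measurable fun s =>
      ENNReal.ofReal (Real.exp (∑ n ∈ Finset.Icc 1 t, ζ n (r.act n s) s)) :=
    (Real.measurable_exp.comp (hr.measurable_sum hζ t)).ennreal_ofReal
  have h3 := meas_ge_le_lintegral_div (μ := P) hm.aemeasurable (ε := ENNReal.ofReal (Real.exp x))
    (by simp [Real.exp_pos]) ENNReal.ofReal_ne_top
  refine le_trans (measure_mono fun s hs => ?_) (h3.trans ?_)
  · exact ENNReal.ofReal_le_ofReal (Real.exp_le_exp.2 hs)
  · rw [Real.exp_neg, ENNReal.ofReal_inv_of_pos (Real.exp_pos x), ← one_div]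
    exact ENNReal.div_le_div_right h1 _

end Supermartingale

/-! ### Chernoff exponents -/

section Chernoff

/-- For a law with exponential moments, every one-sided deviation from the mean has an exponential
moment that is below `1` by a positive margin; `ς = 1` and `ς = -1` give the two sides. -/
lemma exists_exponent {Q : Measure ℝ} [IsProbabilityMeasure Q]
    (h0 : 0 ∈ interior (integrableExpSet id Q)) {ξ : ℝ} (hξ : 0 < ξ) (ς : ℝ) :
    ∃ l > 0, ∃ c > 0, ∫⁻ x, ENNReal.ofReal
      (Real.exp (l * (ς * (x - ∫ y, y ∂Q) - ξ) + c)) ∂Q ≤ 1 := by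
  set μ := ∫ y, y ∂Q with hμ
  set ψ : ℝ → ℝ := fun l => mgf id Q (ς * l) * Real.exp (-(ς * μ + ξ) * l) with hψ
  have hmgf : HasDerivAt (mgf id Q) μ (ς * 0) := by
    have := hasDerivAt_mgf (X := id) h0
    rw [mul_zero]
    simpa using this
  have hd : HasDerivAt ψ (-ξ) 0 := by
    have h1 : HasDerivAt (fun l => mgf id Q (ς * l)) (μ * (ς * 1)) 0 :=
      hmgf.comp (0 : ℝ) ((hasDerivAt_id (0 : ℝ)).const_mul ς)
    have h2 : HasDerivAt (fun l => Real.exp (-(ς * μ + ξ) * l))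
        (Real.exp (-(ς * μ + ξ) * 0) * (-(ς * μ + ξ) * 1)) 0 :=
      ((hasDerivAt_id (0 : ℝ)).const_mul _).exp
    have h3 := h1.mul h2
    simp only [mul_zero, mgf_zero, Real.exp_zero, one_mul, mul_one] at h3
    exact h3.congr_deriv (by ring)
  have hψ0 : ψ 0 = 1 := by simp [hψ]
  have hlt : ∀ᶠ l in 𝓝[>] (0 : ℝ), ψ l < 1 := by
    have h1 := (hasDerivWithinAt_iff_tendsto_slope' (s := Set.Ioi (0 : ℝ)) (by simp)).1
      hd.hasDerivWithinAt
    filter_upwards [h1.eventually_lt_const (show -ξ < 0 by linarith), self_mem_nhdsWithin]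
      with l hl hl0
    rw [slope_def_field, hψ0, sub_zero] at hl
    have := (div_neg_iff.1 hl).resolve_left (fun h => absurd h.2 (not_lt.2 (le_of_lt hl0)))
    linarith [this.1]
  have hint : ∀ᶠ l in 𝓝[>] (0 : ℝ), ς * l ∈ integrableExpSet id Q := by
    have h1 : Tendsto (fun l => ς * l) (𝓝[>] (0 : ℝ)) (𝓝 0) := by
      have : Tendsto (fun l => ς * l) (𝓝 (0 : ℝ)) (𝓝 (ς * 0)) :=
        (continuous_const.mul continuous_id).tendsto _
      rw [mul_zero] at this
      exact this.mono_left nhdsWithin_le_nhds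
    exact h1.eventually (mem_interior_iff_mem_nhds.1 h0)
  obtain ⟨l, hl1, hl2, hl0⟩ := (hlt.and (hint.and self_mem_nhdsWithin)).exists
  have hψpos : 0 < ψ l := mul_pos (mgf_pos hl2) (Real.exp_pos _)
  refine ⟨l, hl0, -Real.log (ψ l), by linarith [Real.log_neg hψpos hl1], ?_⟩
  have e : ∀ x : ℝ, Real.exp (l * (ς * (x - μ) - ξ) + -Real.log (ψ l))
      = ((ψ l)⁻¹ * Real.exp (-(ς * μ + ξ) * l)) * Real.exp (ς * l * id x) := by
    intro x
    rw [Real.exp_add, Real.exp_neg, Real.exp_log hψpos, mul_comm _ (ψ l)⁻¹, mul_assoc,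
      ← Real.exp_add]
    congr 2
    simp only [id]
    ring
  simp_rw [e]
  rw [← ofReal_integral_eq_lintegral_ofReal (Integrable.const_mul hl2 _)
    (Eventually.of_forall fun x => by positivity), integral_const_mul]
  change ENNReal.ofReal ((ψ l)⁻¹ * Real.exp (-(ς * μ + ξ) * l) * mgf id Q (ς * l)) ≤ 1
  have : (ψ l)⁻¹ * Real.exp (-(ς * μ + ξ) * l) * mgf id Q (ς * l) = 1 := by
    rw [mul_assoc, mul_comm (Real.exp _)]
    exact inv_mul_cancel₀ hψpos.ne'
  rw [this, ENNReal.ofReal_one]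

lemma zero_mem_interior_integrableExpSet_expFamily {ρ : Measure ℝ} {θ : ℝ}
    (hθ : θ ∈ paramSpace ρ) : 0 ∈ interior (integrableExpSet id (expFamily ρ θ)) := by
  rw [mem_interior_iff_mem_nhds]
  have h1 : Tendsto (fun t : ℝ => θ + t) (𝓝 0) (𝓝 θ) := by
    have : Tendsto (fun t : ℝ => θ + t) (𝓝 0) (𝓝 (θ + 0)) :=
      (continuous_const.add continuous_id).tendsto _
    rwa [add_zero] at this
  filter_upwards [h1.eventually ((isOpen_paramSpace ρ).mem_nhds hθ)] with t ht
  change Integrable (fun x => Real.exp (t * id x)) (expFamily ρ θ)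
  rw [expFamily_eq_tilted hθ, integrable_tilted_iff (integrable_exp_of_mem_paramSpace hθ)]
  refine (integrable_exp_of_mem_paramSpace ht).congr (Eventually.of_forall fun x => ?_)
  simp only [smul_eq_mul]
  rw [← Real.exp_add, add_mul]

end Chernoff

/-! ### Integrability of the last time of a rare event -/

section LastTime

variable {Ω : Type*} [MeasurableSpace Ω] {P : Measure Ω}

/-- The last time at which the event `B t` occurs is dominated by an integrable random variable. -/
def LastTimeIntegrable (P : Measure Ω) (B : ℕ → Ω → Prop) : Prop :=
  ∃ X : Ω → ℝ≥0∞, Measurable X ∧ ∫⁻ s, X s ∂P ≠ ∞ ∧ ∀ s t, B t s → (t : ℝ≥0∞) ≤ X s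

lemma LastTimeIntegrable.exists_finite {ι : Type*} [Finite ι] {B : ι → ℕ → Ω → Prop}
    (h : ∀ i, LastTimeIntegrable P (B i)) : LastTimeIntegrable P (fun t s => ∃ i, B i t s) := by
  have := Fintype.ofFinite ι
  choose X hm hi hB using h
  refine ⟨fun s => ∑ i, X i s, Finset.measurable_fun_sum _ fun i _ => hm i, ?_, ?_⟩
  · rw [lintegral_finsetSum _ fun i _ => hm i]
    exact ENNReal.sum_ne_top.2 fun i _ => hi i
  · rintro s t ⟨i, hi⟩
    exact (hB i s t hi).trans
      (Finset.single_le_sum (f := fun i => X i s) (fun _ _ => zero_le) (Finset.mem_univ i))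

lemma LastTimeIntegrable.or {B B' : ℕ → Ω → Prop}
    (h : LastTimeIntegrable P B) (h' : LastTimeIntegrable P B') :
    LastTimeIntegrable P (fun t s => B t s ∨ B' t s) := by
  obtain ⟨X, hm, hi, hB⟩ := h
  obtain ⟨X', hm', hi', hB'⟩ := h'
  refine ⟨fun s => X s + X' s, hm.add hm', ?_, ?_⟩
  · rw [lintegral_add_left hm]
    exact ENNReal.add_ne_top.2 ⟨hi, hi'⟩
  · rintro s t (h | h)
    · exact (hB s t h).trans le_self_add
    · exact (hB' s t h).trans le_add_self

lemma summable_mul_exp_neg_sqrt {c : ℝ} (hc : 0 < c) (k : ℝ) :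
    Summable fun t : ℕ => (t : ℝ) * Real.exp (-(c * (√t - k))) := by
  have hsum : Summable fun t : ℕ => (720 * Real.exp (c * k) / c ^ 6) * (1 / (t : ℝ) ^ 2) :=
    (Real.summable_one_div_nat_pow.2 (by norm_num)).mul_left _
  refine Summable.of_nonneg_of_le (fun t => by positivity) (fun t => ?_) hsum
  rcases Nat.eq_zero_or_pos t with h0 | h0
  · simp [h0]
  · have ht : (0 : ℝ) < t := by exact_mod_cast h0
    -- The sixth power makes `t * exp (-c √t)` summable, and `6 ! = 720`.
    have h1 := Real.pow_div_factorial_le_exp (c * √t) (by positivity) 6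
    have h2 : (c * √t) ^ 6 = c ^ 6 * (t : ℝ) ^ 3 := by
      rw [mul_pow, show √(t : ℝ) ^ 6 = (√(t : ℝ) ^ 2) ^ 3 by ring, Real.sq_sqrt ht.le]
    rw [h2, show ((Nat.factorial 6 : ℕ) : ℝ) = 720 by norm_num [Nat.factorial]] at h1
    have h3 : Real.exp (-(c * (√t - k))) = Real.exp (c * k) / Real.exp (c * √t) := by
      rw [← Real.exp_sub]
      congr 1
      ring
    have h4 : (0 : ℝ) < c ^ 6 * (t : ℝ) ^ 3 / 720 := by positivity
    calc (t : ℝ) * Real.exp (-(c * (√t - k)))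
        ≤ t * (Real.exp (c * k) / (c ^ 6 * (t : ℝ) ^ 3 / 720)) := by
          rw [h3]
          gcongr
      _ = _ := by field_simp

lemma LastTimeIntegrable.of_measure_le {B : ℕ → Ω → Prop} (hB : ∀ t, MeasurableSet {s | B t s})
    {c : ℝ} (hc : 0 < c) {k : ℝ}
    (hle : ∀ t, P {s | B t s} ≤ ENNReal.ofReal (Real.exp (-(c * (√t - k))))) :
    LastTimeIntegrable P B := by
  refine ⟨fun s => ∑' t : ℕ, {s | B t s}.indicator (fun _ => (t : ℝ≥0∞)) s,
    Measurable.tsum fun t => measurable_const.indicator (hB t), ?_, ?_⟩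
  · rw [lintegral_tsum fun t => (measurable_const.indicator (hB t)).aemeasurable]
    have h1 : ∀ t : ℕ, ∫⁻ s, {s | B t s}.indicator (fun _ => (t : ℝ≥0∞)) s ∂P
        ≤ ENNReal.ofReal ((t : ℝ) * Real.exp (-(c * (√t - k)))) := by
      intro t
      rw [lintegral_indicator_const (hB t), ENNReal.ofReal_mul (by positivity),
        ENNReal.ofReal_natCast]
      gcongr
      exact hle t
    refine ne_top_of_le_ne_top ?_ (ENNReal.tsum_le_tsum h1)
    rw [← ENNReal.ofReal_tsum_of_nonneg (fun t => by positivity) (summable_mul_exp_neg_sqrt hc k)]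
    exact ENNReal.ofReal_ne_top
  · intro s t h
    refine le_trans ?_ (ENNReal.le_tsum t)
    rw [Set.indicator_of_mem (show s ∈ {s | B t s} from h)]

end LastTime

/-! ### Concentration of the estimates -/

section Concentration

variable {V Ω : Type*} [MeasurableSpace V] {mΩ : MeasurableSpace Ω} {r : Run V Ω} {ν : Model V}
  {σ : Setting} {P : Measure Ω} [IsProbabilityMeasure P]

lemma Run.IsInteraction.lintegral_edge (hr : r.IsInteraction ν σ P) (n : ℕ) (v u : V)
    (f : ℝ → ℝ≥0∞) :
    ∫⁻ s, f (r.edge n v u s) ∂P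
      = f 1 * ENNReal.ofReal (ν.G v u) + f 0 * (1 - ENNReal.ofReal (ν.G v u)) := by
  have hm : MeasurableSet {s | r.edge n v u s = 1} :=
    hr.measurable_edge n v u (measurableSet_singleton 1)
  rw [← lintegral_add_compl _ hm]
  congr 1
  · rw [setLIntegral_congr_fun (g := fun _ => f 1) hm fun s hs => by
      rw [show r.edge n v u s = 1 from hs]]
    rw [setLIntegral_const, hr.edge_law]
  · rw [setLIntegral_congr_fun (g := fun _ => f 0) hm.compl fun s hs => by
      rw [(hr.edge_zero_or_one n v u s).resolve_right hs]]
    rw [setLIntegral_const, prob_compl_eq_one_sub hm, hr.edge_law]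

lemma Run.IsInteraction.integral_edge (hr : r.IsInteraction ν σ P) (n : ℕ) (v u : V) :
    ∫ s, r.edge n v u s ∂P = ν.G v u := by
  rw [integral_eq_lintegral_of_nonneg_ae
    (Eventually.of_forall fun s => by
      rcases hr.edge_zero_or_one n v u s with h | h <;> simp [h])
    (hr.measurable_edge n v u).aestronglyMeasurable,
    hr.lintegral_edge n v u (fun x => ENNReal.ofReal x)]
  simp [(ν.weight_mem v u).1]

lemma Run.IsInteraction.exists_edge_exponent (hr : r.IsInteraction ν σ P) (v u : V) {ξ : ℝ}
    (hξ : 0 < ξ) (ς : ℝ) :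
    ∃ l > 0, ∃ c > 0, ∀ n, ∫⁻ s, ENNReal.ofReal
      (Real.exp (l * (ς * (r.edge n v u s - ν.G v u) - ξ) + c)) ∂P ≤ 1 := by
  have hme := hr.measurable_edge 0 v u
  have : IsProbabilityMeasure (P.map (r.edge 0 v u)) :=
    Measure.isProbabilityMeasure_map hme.aemeasurable
  have hint : integrableExpSet id (P.map (r.edge 0 v u)) = Set.univ := by
    rw [Set.eq_univ_iff_forall]
    intro t
    change Integrable (fun x => Real.exp (t * id x)) _
    rw [integrable_map_measure (by fun_prop) hme.aemeasurable]
    refine Integrable.of_bound (by fun_prop) (Real.exp |t|) (Eventually.of_forall fun s => ?_)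
    simp only [Function.comp, id, Real.norm_eq_abs, Real.abs_exp]
    rcases hr.edge_zero_or_one 0 v u s with h | h <;> rw [h] <;> simp [le_abs_self]
  obtain ⟨l, hl, c, hc, h⟩ := exists_exponent (Q := P.map (r.edge 0 v u))
    (by rw [hint]; simp) hξ ς
  have hmean : ∫ y, y ∂(P.map (r.edge 0 v u)) = ν.G v u := by
    rw [integral_map hme.aemeasurable (by fun_prop), hr.integral_edge]
  refine ⟨l, hl, c, hc, fun n => ?_⟩
  rw [hmean, lintegral_map (by fun_prop) hme] at h
  rw [hr.lintegral_edge 0 v u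
    (fun x => ENNReal.ofReal (Real.exp (l * (ς * (x - ν.G v u) - ξ) + c)))] at h
  rwa [hr.lintegral_edge n v u
    (fun x => ENNReal.ofReal (Real.exp (l * (ς * (x - ν.G v u) - ξ) + c)))]

/-- The increment is counted only if the edge is active, and a mixture with the factor `1` keeps the
exponential moment below `1`. -/
lemma Run.IsInteraction.exists_rew_exponent (hr : r.IsInteraction ν σ P) (u : V) {ξ : ℝ}
    (hξ : 0 < ξ) (ς : ℝ) :
    ∃ l > 0, ∃ c > 0, ∀ n v, ∫⁻ s, ENNReal.ofReal
      (Real.exp (r.edge n v u s * (l * (ς * (r.rew n u s - ν.mean u) - ξ) + c))) ∂P ≤ 1 := by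
  have : IsProbabilityMeasure (expFamily ν.ρ (ν.θ u)) := by
    rw [← hr.rew_law 0 u]
    exact Measure.isProbabilityMeasure_map (hr.measurable_rew 0 u).aemeasurable
  obtain ⟨l, hl, c, hc, h⟩ := exists_exponent
    (zero_mem_interior_integrableExpSet_expFamily (ν.param_mem u)) hξ ς
  refine ⟨l, hl, c, hc, fun n v => ?_⟩
  set g : ℝ → ℝ≥0∞ := fun x =>
    ENNReal.ofReal (Real.exp (l * (ς * (x - ν.mean u) - ξ) + c)) with hg
  have hgm : Measurable g := by fun_prop
  have hme := hr.measurable_edge n v u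
  have hmr := hr.measurable_rew n u
  have hrew : ∫⁻ s, g (r.rew n u s) ∂P ≤ 1 := by
    rw [← lintegral_map hgm hmr, hr.rew_law]
    exact h
  have hind : IndepFun (r.edge n v u) (r.rew n u) P :=
    hr.indep.indepFun (i := (n, Sum.inl (v, u))) (j := (n, Sum.inr u)) (by simp)
  have hpt : ∀ s, ENNReal.ofReal
      (Real.exp (r.edge n v u s * (l * (ς * (r.rew n u s - ν.mean u) - ξ) + c)))
      = ENNReal.ofReal (1 - r.edge n v u s)
        + ENNReal.ofReal (r.edge n v u s) * g (r.rew n u s) := by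
    intro s
    rcases hr.edge_zero_or_one n v u s with h | h <;> rw [h] <;> simp [hg]
  simp_rw [hpt]
  rw [lintegral_add_left (by fun_prop),
    lintegral_mul_eq_lintegral_mul_lintegral_of_indepFun''
      (f := fun s => ENNReal.ofReal (r.edge n v u s)) (g := fun s => g (r.rew n u s))
      (by fun_prop) (by fun_prop) (hind.comp ENNReal.measurable_ofReal hgm)]
  calc _ ≤ ∫⁻ s, ENNReal.ofReal (1 - r.edge n v u s) ∂P
        + ∫⁻ s, ENNReal.ofReal (r.edge n v u s) ∂P := by
        gcongr
        exact mul_le_of_le_one_right' hrew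
    _ = ∫⁻ s, (ENNReal.ofReal (1 - r.edge n v u s) + ENNReal.ofReal (r.edge n v u s)) ∂P := by
        rw [lintegral_add_left (by fun_prop)]
    _ = 1 := by
        rw [lintegral_congr (g := fun _ => 1) fun s => ?_, lintegral_one, measure_univ]
        rcases hr.edge_zero_or_one n v u s with h | h <;> rw [h] <;> simp

end Concentration

section Frequencies

variable {V Ω : Type*}

open Classical in
/-- The number of activations of the edge `(v, u)` in rounds that chose `v`. -/
noncomputable def Run.activations (r : Run V Ω) (t : ℕ) (s : Ω) (v u : V) : ℝ :=
  ∑ n ∈ Finset.Icc 1 t, if r.act n s = v then r.edge n v u s else 0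

/-- The number of rounds in which an edge into `u` was activated. -/
def Run.inActivations (r : Run V Ω) (t : ℕ) (s : Ω) (u : V) : ℝ :=
  ∑ n ∈ Finset.Icc 1 t, r.edge n (r.act n s) u s

lemma sum_activations [Fintype V] (r : Run V Ω) (t : ℕ) (s : Ω) (u : V) :
    ∑ v, r.activations t s v u = r.inActivations t s u := by
  classical
  unfold Run.activations Run.inActivations
  rw [Finset.sum_comm]
  exact Finset.sum_congr rfl fun n _ => by rw [Finset.sum_ite_eq]; simp

variable [Fintype V] [MeasurableSpace V] [MeasurableSingletonClass V]
  {mΩ : MeasurableSpace Ω} {r : Run V Ω} {ν : Model V} {σ : Setting} {P : Measure Ω}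
  [IsProbabilityMeasure P]

lemma Run.IsInteraction.lastTimeIntegrable_ge (hr : r.IsInteraction ν σ P) {ζ : ℕ → V → Ω → ℝ}
    (hζ : ∀ n v, Measurable[r.noiseSigma {n}] (ζ n v))
    (hle : ∀ n v, ∫⁻ s, ENNReal.ofReal (Real.exp (ζ n v s)) ∂P ≤ 1) {c : ℝ} (hc : 0 < c) (k : ℝ) :
    LastTimeIntegrable P
      (fun t s => c * (√t - k) ≤ ∑ n ∈ Finset.Icc 1 t, ζ n (r.act n s) s) :=
  .of_measure_le (fun t => measurableSet_le measurable_const (hr.measurable_sum hζ t)) hc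
    fun t => hr.measure_ge_le_exp hζ hle t _

lemma Run.IsInteraction.lastTimeIntegrable_activations (hr : r.IsInteraction ν σ P) (v u : V)
    {ξ : ℝ} (hξ : 0 < ξ) (ς k : ℝ) :
    LastTimeIntegrable P (fun t s => √t - k ≤ r.visits t s v ∧
      ξ * r.visits t s v ≤ ς * (r.activations t s v u - ν.G v u * r.visits t s v)) := by
  classical
  obtain ⟨l, hl, c, hc, hle⟩ := hr.exists_edge_exponent v u hξ ς
  -- Only the rounds that choose `v` contribute.
  set ζ : ℕ → V → Ω → ℝ := fun n v' s =>
    if v' = v then l * (ς * (r.edge n v u s - ν.G v u) - ξ) + c else 0 with hζ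
  obtain ⟨X, hX, hi, hB⟩ := hr.lastTimeIntegrable_ge (ζ := ζ) (fun n v' => by
      have := measurable_edge_noiseSigma r (Set.mem_singleton n) v u
      by_cases h : v' = v
      · simp only [hζ, h, if_true]
        exact ((((this.sub_const _).const_mul _).sub_const _).const_mul _).add_const _
      · simp only [hζ, h, if_false]
        exact measurable_const)
    (fun n v' => by
      by_cases h : v' = v
      · simpa only [hζ, h, if_true] using hle n
      · simp [hζ, h]) hc k
  refine ⟨X, hX, hi, fun s t ⟨h1, h2⟩ => hB s t ?_⟩
  have hsum : ∑ n ∈ Finset.Icc 1 t, ζ n (r.act n s) s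
      = l * (ς * (r.activations t s v u - ν.G v u * r.visits t s v) - ξ * r.visits t s v)
        + c * r.visits t s v := by
    simp only [Run.activations, Run.visits, Finset.mul_sum, ← Finset.sum_sub_distrib,
      ← Finset.sum_add_distrib]
    refine Finset.sum_congr rfl fun n _ => ?_
    simp only [hζ]
    split_ifs <;> ring
  beta_reduce
  rw [hsum]
  have h3 := mul_le_mul_of_nonneg_left h1 hc.le
  have h4 := mul_nonneg hl.le (sub_nonneg.2 h2)
  linarith

lemma Run.IsInteraction.lastTimeIntegrable_feedback (hr : r.IsInteraction ν σ P) (u : V)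
    {ξ : ℝ} (hξ : 0 < ξ) (ς k : ℝ) {g : ℝ} (hg : 0 < g) :
    LastTimeIntegrable P (fun t s => g * (√t - k) ≤ r.inActivations t s u ∧
      ξ * r.inActivations t s u ≤ ς * (∑ n ∈ Finset.Icc 1 t, r.feedback n u s
        - ν.mean u * r.inActivations t s u)) := by
  obtain ⟨l, hl, c, hc, hle⟩ := hr.exists_rew_exponent u hξ ς
  set ζ : ℕ → V → Ω → ℝ := fun n v s =>
    r.edge n v u s * (l * (ς * (r.rew n u s - ν.mean u) - ξ) + c) with hζ
  obtain ⟨X, hX, hi, hB⟩ := hr.lastTimeIntegrable_ge (ζ := ζ) (fun n v => by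
      have h1 := measurable_edge_noiseSigma r (Set.mem_singleton n) v u
      have h2 := measurable_rew_noiseSigma r (Set.mem_singleton n) u
      exact h1.mul (((((h2.sub_const _).const_mul _).sub_const _).const_mul _).add_const _))
    hle (mul_pos hc hg) k
  refine ⟨X, hX, hi, fun s t ⟨h1, h2⟩ => hB s t ?_⟩
  have hsum : ∑ n ∈ Finset.Icc 1 t, ζ n (r.act n s) s
      = l * (ς * (∑ n ∈ Finset.Icc 1 t, r.feedback n u s - ν.mean u * r.inActivations t s u)
        - ξ * r.inActivations t s u) + c * r.inActivations t s u := by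
    simp only [Run.inActivations, Run.feedback, Finset.mul_sum, ← Finset.sum_sub_distrib,
      ← Finset.sum_add_distrib]
    refine Finset.sum_congr rfl fun n _ => ?_
    simp only [hζ]
    ring
  beta_reduce
  rw [hsum]
  have h3 := mul_le_mul_of_nonneg_left h1 hc.le
  have h4 := mul_nonneg hl.le (sub_nonneg.2 h2)
  linarith

end Frequencies

/-! ### Accuracy of the estimates -/

section Accuracy

variable {V Ω : Type*} [MeasurableSpace V] {mΩ : MeasurableSpace Ω} {r : Run V Ω} {ν : Model V}
  {σ : Setting} {P : Measure Ω}

/-- Rewards without atoms do not vanish, so nonzero feedback identifies the activated edges. -/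
lemma Run.IsInteraction.ae_observed_iff [Countable V] (hr : r.IsInteraction ν σ P)
    (hcont : σ = Setting.uninformed → ∀ x : ℝ, ν.ρ {x} = 0) :
    ∀ᵐ s ∂P, ∀ n u, r.Observed σ n u s ↔ r.edge n (r.act n s) u s = 1 := by
  cases σ with
  | informed => exact Eventually.of_forall fun s n u => Iff.rfl
  | informedKnownGraph => exact Eventually.of_forall fun s n u => Iff.rfl
  | uninformed =>
    have hne : ∀ᵐ s ∂P, ∀ n u, r.rew n u s ≠ 0 := by
      rw [ae_all_iff]
      intro n
      rw [ae_all_iff]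
      intro u
      have h0 : P.map (r.rew n u) {0} = 0 := by
        rw [hr.rew_law]
        exact withDensity_absolutelyContinuous _ _ (hcont rfl 0)
      rw [Measure.map_apply (hr.measurable_rew n u) (measurableSet_singleton 0)] at h0
      rw [ae_iff]
      simpa [Set.preimage] using h0
    filter_upwards [hne] with s hs n u
    change r.edge n (r.act n s) u s * r.rew n u s ≠ 0 ↔ _
    rcases hr.edge_zero_or_one n (r.act n s) u s with h | h <;> simp [h, hs n u]

lemma edgeCount_eq_activations (hr : r.IsInteraction ν σ P) {s : Ω}
    (h : ∀ n u, r.Observed σ n u s ↔ r.edge n (r.act n s) u s = 1) (t : ℕ) (v u : V) :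
    r.edgeCount σ t s v u = r.activations t s v u := by
  classical
  unfold Run.edgeCount Run.activations
  refine Finset.sum_congr rfl fun n _ => ?_
  by_cases hv : r.act n s = v
  · have h1 := h n u
    rw [hv] at h1
    rcases hr.edge_zero_or_one n v u s with h2 | h2 <;> simp [hv, h1, h2]
  · simp [hv]

lemma obsCount_eq_inActivations [Fintype V] (hr : r.IsInteraction ν σ P) {s : Ω}
    (h : ∀ n u, r.Observed σ n u s ↔ r.edge n (r.act n s) u s = 1) (t : ℕ) (u : V) :
    r.obsCount σ t s u = r.inActivations t s u := by
  unfold Run.obsCount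
  rw [← sum_activations]
  exact Finset.sum_congr rfl fun v _ => edgeCount_eq_activations hr h t v u

lemma Run.IsInteraction.activations_nonneg (hr : r.IsInteraction ν σ P) (t : ℕ) (s : Ω) (v u : V) :
    0 ≤ r.activations t s v u := by
  refine Finset.sum_nonneg fun n _ => ?_
  split_ifs
  · rcases hr.edge_zero_or_one n v u s with h | h <;> simp [h]
  · exact le_rfl

lemma Run.IsInteraction.activations_le_visits (hr : r.IsInteraction ν σ P) (t : ℕ) (s : Ω)
    (v u : V) : r.activations t s v u ≤ r.visits t s v := by
  refine Finset.sum_le_sum fun n _ => ?_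
  split_ifs
  · rcases hr.edge_zero_or_one n v u s with h | h <;> simp [h]
  · exact le_rfl

lemma abs_div_sub_le {x y z ξ : ℝ} (hy : 0 < y) (h1 : ¬ ξ * y ≤ 1 * (x - z * y))
    (h2 : ¬ ξ * y ≤ -1 * (x - z * y)) : |x / y - z| ≤ ξ := by
  rw [show x / y - z = (x - z * y) / y by field_simp, abs_div, abs_of_pos hy, div_le_iff₀ hy,
    abs_le]
  constructor <;> linarith

variable [Fintype V] [MeasurableSingletonClass V] [IsProbabilityMeasure P]

/-- The last time of an inaccurate estimate is integrable. Forced exploration visits every vertex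
about `√t` times, so that the probability of a deviation decays exponentially in `√t`. -/
lemma Run.IsInteraction.lastTimeIntegrable_not_accurate (hr : r.IsInteraction ν σ P) {ξ : ℝ}
    (hξ : 0 < ξ) :
    LastTimeIntegrable P (fun t s =>
      (∀ n u, r.Observed σ n u s ↔ r.edge n (r.act n s) u s = 1) ∧
      (∀ v, √t - (Fintype.card V + 2) ≤ r.visits t s v) ∧ ¬ r.Accurate ν σ ξ t s) := by
  set k : ℝ := (Fintype.card V : ℝ) + 2 with hk
  have hk0 : 0 ≤ k := by positivity
  choose p hp using ν.observable
  -- At precision `η` the estimate of a positive weight is at least half of the weight, which bounds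
  -- the number of observations of `u` from below by that of the visits of `p u`.
  set η : V → V → ℝ := fun v u => if 0 < ν.G v u then min ξ (ν.G v u / 2) else ξ with hη
  have hη0 : ∀ v u, 0 < η v u := by
    intro v u
    simp only [hη]
    split_ifs with h
    · exact lt_min hξ (by linarith)
    · exact hξ
  have hηle : ∀ v u, η v u ≤ ξ := by
    intro v u
    simp only [hη]
    split_ifs with h
    · exact min_le_left _ _
    · exact le_rfl
  have hηp : ∀ u, η (p u) u ≤ ν.G (p u) u / 2 := by
    intro u
    simp only [hη, if_pos (hp u)]
    exact min_le_right _ _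
  have hE := LastTimeIntegrable.exists_finite fun i : V × V =>
    (hr.lastTimeIntegrable_activations i.1 i.2 (hη0 i.1 i.2) 1 k).or
      (hr.lastTimeIntegrable_activations i.1 i.2 (hη0 i.1 i.2) (-1) k)
  have hR := LastTimeIntegrable.exists_finite fun u : V =>
    (hr.lastTimeIntegrable_feedback u hξ 1 k (half_pos (hp u))).or
      (hr.lastTimeIntegrable_feedback u hξ (-1) k (half_pos (hp u)))
  have hT : LastTimeIntegrable P fun (t : ℕ) _ => √t ≤ k := by
    refine ⟨fun _ => ENNReal.ofReal (k ^ 2), measurable_const, by simp, fun s t h => ?_⟩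
    rw [← ENNReal.ofReal_natCast]
    exact ENNReal.ofReal_le_ofReal ((Real.sqrt_le_left hk0).1 h)
  obtain ⟨X, hX, hi, hB⟩ := hT.or (hE.or hR)
  refine ⟨X, hX, hi, fun s t ⟨hobs, hvis, hacc⟩ => hB s t ?_⟩
  by_contra hgood
  simp only [not_or, not_exists, not_and, not_le] at hgood
  obtain ⟨hk', hgE, hgR⟩ := hgood
  refine hacc ?_
  have hkpos : 0 < √(t : ℝ) - k := by linarith
  have hN : ∀ v, 0 < r.visits t s v := fun v => hkpos.trans_le (hvis v)
  have hG : ∀ v u, |r.activations t s v u / r.visits t s v - ν.G v u| ≤ η v u := fun v u =>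
    abs_div_sub_le (hN v) (not_le.2 ((hgE (v, u)).1 (hvis v))) (not_le.2 ((hgE (v, u)).2 (hvis v)))
  have hM : ∀ u, ν.G (p u) u / 2 * (√t - k) ≤ r.inActivations t s u := by
    intro u
    have h1 : r.activations t s (p u) u ≤ r.inActivations t s u := by
      rw [← sum_activations]
      exact Finset.single_le_sum (f := fun v => r.activations t s v u)
        (fun v _ => hr.activations_nonneg t s v u) (Finset.mem_univ _)
    have h2 : ν.G (p u) u / 2 ≤ r.activations t s (p u) u / r.visits t s (p u) := by
      linarith [(abs_le.1 (hG (p u) u)).1, hηp u]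
    rw [le_div_iff₀ (hN _)] at h2
    exact (mul_le_mul_of_nonneg_left (hvis (p u)) (half_pos (hp u)).le).trans (h2.trans h1)
  have hMpos : ∀ u, 0 < r.inActivations t s u := fun u =>
    (mul_pos (half_pos (hp u)) hkpos).trans_le (hM u)
  have hgraph : ∀ v u, r.graphEst ν σ t s v u ∈ Set.Icc (0 : ℝ) 1 ∧
      |r.graphEst ν σ t s v u - ν.G v u| ≤ ξ := by
    intro v u
    have h1 : r.edgeCount σ t s v u / r.visits t s v ∈ Set.Icc (0 : ℝ) 1 ∧
        |r.edgeCount σ t s v u / r.visits t s v - ν.G v u| ≤ ξ := by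
      rw [edgeCount_eq_activations hr hobs]
      exact ⟨⟨div_nonneg (hr.activations_nonneg t s v u) (hN v).le,
        div_le_one_of_le₀ (hr.activations_le_visits t s v u) (hN v).le⟩,
        (hG v u).trans (hηle v u)⟩
    cases σ with
    | uninformed => exact h1
    | informed => exact h1
    | informedKnownGraph =>
      refine ⟨ν.weight_mem v u, ?_⟩
      simpa [Run.graphEst] using hξ.le
  refine ⟨fun u => ?_, fun v u => (hgraph v u).1, fun v u => (hgraph v u).2, fun u => ?_⟩
  · rw [obsCount_eq_inActivations hr hobs]
    exact hMpos u
  · rw [Run.meanEst, obsCount_eq_inActivations hr hobs]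
    exact abs_div_sub_le (hMpos u) (not_le.2 ((hgR u).1 (hM u))) (not_le.2 ((hgR u).2 (hM u)))

end Accuracy

/-! ### Bounds on the stopping time -/

section Conclusion

/-- The rates `κ` that approximate `T⋆⁻¹` from below. -/
lemma exists_rate_seq {V : Type*} [Fintype V] [Nontrivial V] (ν : Model V) :
    ∃ κ : ℕ → ℝ, (∀ j, 0 < κ j ∧ κ j < ν.charTime⁻¹) ∧
      Tendsto (fun j => ENNReal.ofReal (κ j)⁻¹) atTop (𝓝 (ENNReal.ofReal ν.charTime)) := by
  have hF : 0 < ν.charTime⁻¹ := inv_pos.2 ν.charTime_pos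
  obtain ⟨κ, -, hκ, hlim⟩ := exists_seq_strictMono_tendsto' hF
  refine ⟨κ, hκ, ENNReal.tendsto_ofReal ?_⟩
  simpa using hlim.inv₀ hF.ne'

variable {V Ω : Type*} [Fintype V] [Nontrivial V] [MeasurableSpace V] [MeasurableSingletonClass V]
  {mΩ : MeasurableSpace Ω} {r : Run V Ω} {ν : Model V} {σ : Setting} {P : Measure Ω}
  [IsProbabilityMeasure P] {w : ℕ → Ω → V → ℝ}

/-- For every `κ < T⋆⁻¹` the stopping time exceeds `thresholdConst / κ` by at most an integrable
random variable that does not depend on `δ`. -/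
lemma Run.IsInteraction.exists_stopTime_le_add (hr : r.IsInteraction ν σ P)
    (hcont : σ = Setting.uninformed → ∀ x : ℝ, ν.ρ {x} = 0)
    (hw : r.IsAveragedDTracking ν σ P w) {κ : ℝ} (hκ0 : 0 < κ) (hκ : κ < ν.charTime⁻¹) :
    ∃ Y : Ω → ℝ≥0∞, Measurable Y ∧ ∫⁻ s, Y s ∂P ≠ ∞ ∧ ∀ᵐ s ∂P, ∀ δ : ℝ,
      (r.stopTime ν σ δ s : ℝ≥0∞) ≤
        ENNReal.ofReal (thresholdConst (Fintype.card V) δ / κ) + Y s := by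
  obtain ⟨ξ, hξ, C, hC, hstopTime⟩ := ν.exists_stopTime_le σ r w hκ0 hκ
  obtain ⟨X, hX, hi, hB⟩ := hr.lastTimeIntegrable_not_accurate hξ
  refine ⟨fun s => ENNReal.ofReal C * (X s + 1), (hX.add_const 1).const_mul _, ?_, ?_⟩
  · rw [lintegral_const_mul _ (hX.add_const 1), lintegral_add_left hX]
    refine ENNReal.mul_ne_top ENNReal.ofReal_ne_top (ENNReal.add_ne_top.2 ⟨hi, by simp⟩)
  · filter_upwards [hr.ae_observed_iff hcont, ae_lt_top hX hi, hw.mem_simplex, hw.optimal,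
      hw.forced, hw.tracking] with s hobs hfin h1 h2 h3 h4 δ
    set n₀ : ℕ := ⌊(X s).toReal⌋₊ with hn₀
    have hn₀X : (n₀ : ℝ≥0∞) ≤ X s := by
      rw [← ENNReal.ofReal_toReal hfin.ne, ← ENNReal.ofReal_natCast]
      exact ENNReal.ofReal_le_ofReal (Nat.floor_le ENNReal.toReal_nonneg)
    have hacc : ∀ t, n₀ < t → r.Accurate ν σ ξ t s := by
      intro t ht
      by_contra hbad
      have hvis : ∀ v, √t - (Fintype.card V + 2) ≤ r.visits t s v := fun v => by
        linarith [sqrt_sub_le_visits h3 t v]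
      have h5 := hB s t ⟨hobs, hvis, hbad⟩
      have h6 : (t : ℝ) ≤ (X s).toReal := by
        have := ENNReal.toReal_mono hfin.ne h5
        simpa using this
      exact absurd (Nat.le_floor h6) (not_le.2 ht)
    refine (hstopTime s ⟨h1, h2, h3, h4⟩ n₀ hacc δ).trans ?_
    gcongr

lemma limsup_div_log_le {τ : ℝ → ℝ≥0∞} {K : ℕ} (hK : 2 ≤ K) {κ : ℝ} (hκ : 0 < κ) {y : ℝ≥0∞}
    (hy : y ≠ ∞) (hτ : ∀ δ, τ δ ≤ ENNReal.ofReal (thresholdConst K δ / κ) + y) :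
    limsup (fun δ : ℝ => τ δ / ENNReal.ofReal (Real.log (1 / δ))) (𝓝[>] 0)
      ≤ ENNReal.ofReal κ⁻¹ := by
  have h1 : Tendsto (fun δ : ℝ => ENNReal.ofReal
      (thresholdConst K δ / Real.log (1 / δ) * κ⁻¹ + y.toReal * (Real.log (1 / δ))⁻¹)) (𝓝[>] 0)
      (𝓝 (ENNReal.ofReal κ⁻¹)) := by
    refine ENNReal.tendsto_ofReal ?_
    have h2 := ((tendsto_thresholdConst_div hK).mul_const κ⁻¹).add
      (tendsto_log_one_div.inv_tendsto_atTop.const_mul y.toReal)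
    simpa using h2
  rw [← h1.limsup_eq]
  refine limsup_le_limsup ?_
  have h3 : ∀ᶠ δ in 𝓝[>] (0 : ℝ), 0 < thresholdConst K δ / Real.log (1 / δ) :=
    (tendsto_thresholdConst_div hK).eventually_const_lt one_pos
  filter_upwards [tendsto_log_one_div.eventually_gt_atTop 0, h3] with δ hδ hA
  have hA' : 0 < thresholdConst K δ := by
    rcases div_pos_iff.1 hA with h | h
    · exact h.1
    · linarith [h.2]
  calc τ δ / ENNReal.ofReal (Real.log (1 / δ))
      ≤ (ENNReal.ofReal (thresholdConst K δ / κ) + y) / ENNReal.ofReal (Real.log (1 / δ)) :=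
        ENNReal.div_le_div_right (hτ δ) _
    _ = ENNReal.ofReal ((thresholdConst K δ / κ + y.toReal) / Real.log (1 / δ)) := by
        rw [ENNReal.ofReal_div_of_pos hδ, ENNReal.ofReal_add (by positivity) ENNReal.toReal_nonneg,
          ENNReal.ofReal_toReal hy]
    _ = _ := by
        congr 1
        field_simp

end Conclusion

end FeedbackBAI

theorem theorem3 {V : Type*} [Fintype V] [Nontrivial V] [MeasurableSpace V]
    [MeasurableSingletonClass V] {Ω : Type*} [MeasurableSpace Ω] (P : Measure Ω)
    [IsProbabilityMeasure P] (ν : FeedbackBAI.Model V) (σ : FeedbackBAI.Setting)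
    (hcont : σ = FeedbackBAI.Setting.uninformed → ∀ x : ℝ, ν.ρ {x} = 0)
    (r : FeedbackBAI.Run V Ω) (hr : r.IsInteraction ν σ P)
    (w : ℕ → Ω → V → ℝ) (hw : r.IsAveragedDTracking ν σ P w) :
    (∀ δ : ℝ, 0 < δ → δ < 1 / 2 → ∀ᵐ s ∂P, r.stopTime ν σ δ s < ⊤) ∧
    (∀ᵐ s ∂P, limsup
        (fun δ : ℝ => (r.stopTime ν σ δ s : ℝ≥0∞) / ENNReal.ofReal (Real.log (1 / δ))) (𝓝[>] 0)
      ≤ ENNReal.ofReal ν.charTime) ∧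
    limsup
        (fun δ : ℝ => (∫⁻ s, (r.stopTime ν σ δ s : ℝ≥0∞) ∂P) / ENNReal.ofReal (Real.log (1 / δ)))
        (𝓝[>] 0)
      ≤ ENNReal.ofReal ν.charTime := by
  have hK : 2 ≤ Fintype.card V := Fintype.one_lt_card
  obtain ⟨κ, hκ, hlim⟩ := FeedbackBAI.exists_rate_seq ν
  choose Y hYm hYi hY using fun j => hr.exists_stopTime_le_add hcont hw (hκ j).1 (hκ j).2
  have hfin : ∀ᵐ s ∂P, ∀ j, Y j s < ∞ := ae_all_iff.2 fun j => ae_lt_top (hYm j) (hYi j)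
  refine ⟨fun δ _ _ => ?_, ?_, ?_⟩
  · filter_upwards [hfin, hY 0] with s hs hle
    rw [← ENat.toENNReal_lt_top]
    exact (hle δ).trans_lt (ENNReal.add_lt_top.2 ⟨ENNReal.ofReal_lt_top, hs 0⟩)
  · filter_upwards [hfin, ae_all_iff.2 hY] with s hs hle
    exact ge_of_tendsto' hlim fun j =>
      FeedbackBAI.limsup_div_log_le hK (hκ j).1 (hs j).ne (hle j)
  · refine ge_of_tendsto' hlim fun j =>
      FeedbackBAI.limsup_div_log_le hK (hκ j).1 (hYi j) fun δ => ?_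
    calc ∫⁻ s, (r.stopTime ν σ δ s : ℝ≥0∞) ∂P
        ≤ ∫⁻ s, (ENNReal.ofReal
            (FeedbackBAI.thresholdConst (Fintype.card V) δ / κ j) + Y j s) ∂P :=
          lintegral_mono_ae ((hY j).mono fun s hs => hs δ)
      _ = _ := by
          rw [lintegral_add_left measurable_const, lintegral_const, measure_univ, mul_one]
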